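/- Let $k$ be an algebraically closed field of characteristic zero, let $n\ge 0$, $e\ge 1$, $0\le\alpha\le e$, $d\ge 0$ be integers, and let $X\subset\mathbb P^{n+e}_k$ be a reduced algebraic set (a finite union of projective varieties) of dimension $n$ that is not contained in a hyperplane. Let $R=k[x_0,\dots,x_{n+e}]$, let $I_X\subset R$ be the homogeneous ideal of $X$, and for $0\le t\le n+e$ let $S_t=k[x_t,\dots,x_{n+e}]\subset R$. Assume that $X$ does not meet the linear subspace $\Lambda=\{x_\alpha=\dots=x_{n+e}=0\}$ (the $\mathbb P^{\alpha-1}$ with homogeneous coordinates $x_0,\dots,x_{\alpha-1}$). For $S=R$ or $S=S_t$ and a graded $S$-module $M$ put $\beta^S_{i,j}(M)=\dim_k\operatorname{Tor}^S_i(M,k)_{i+j}$, and write $\beta^S_{i,j}=\beta^S_{i,j}(R/I_X)$. One says that $M$ satisfies property $\mathbf N^S_{d,a}$ if $\beta^S_{i,j}(M)=0$ for all $0\le i\le a$ and all $j\ge d$. Suppose that $R/I_X$ satisfies $\mathbf N^R_{d,\alpha}$. (This forces $d\ge 1$.) Then: (a) $R/I_X$, as a graded $S_\alpha$-module, satisfies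 $\mathbf N^{S_\alpha}_{d,0}$. (b) (i) $\beta^{S_\alpha}_{0,0}=1$, $\beta^{S_\alpha}_{0,1}=\alpha$, and $\beta^{S_\alpha}_{0,i}\le\binom{\alpha-1+i}{i}$ for $2\le i\le d-1$. (ii) $\beta^{S_\alpha}_{0,d-1}\le\beta^{S_{\alpha-1}}_{1,d-1}\le\dots\le\beta^{S_1}_{\alpha-1,d-1}\le\beta^R_{\alpha,d-1}$. (c) Suppose $\alpha=e$. Then $R/I_X$ is a free $S_e$-module if and only if $X$ is arithmetically Cohen–Macaulay, i.e. the depth of $R/I_X$ with respect to its irrelevant ideal equals $\dim R/I_X$. In this case the regularity $r=\operatorname{reg}(X)=\max\{j\mid\beta^R_{i,j}(I_X)\ne 0\text{ for some }i\}$ exists and is at least $2$; there is an isomorphism of graded $S_e$-modules $$R/I_X\;\cong\; S_e\oplus S_e(-1)^{e}\oplus S_e(-2)^{\beta^{S_e}_{0,2}}\oplus\dots\oplus S_e(-r+1)^{\beta^{S_e}_{0,r-1}};$$ and, for the projection $\pi_\Lambda:X\to\mathbb P^n$, $[x_0:\dots:x_{n+e}]\mapsto[x_e:\dots:x_{n+e}]$,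 there is an isomorphism of $\mathcal O_{\mathbb P^n}$-modules $$(\pi_\Lambda)_*\mathcal O_X\;\cong\;\mathcal O_{\mathbb P^n}\oplus\mathcal O_{\mathbb P^n}(-1)^{e}\oplus\mathcal O_{\mathbb P^n}(-2)^{\beta^{S_e}_{0,2}}\oplus\dots\oplus\mathcal O_{\mathbb P^n}(-r+1)^{\beta^{S_e}_{0,r-1}}.$$ -/

import Mathlib

open scoped LinearAlgebra.Projectivization

noncomputable section

namespace ProjSyz

open MvPolynomial

/-! ### Graded Betti numbers -/

section Koszul

variable (k σ : Type*) [Field k] [Fintype σ] [LinearOrder σ]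
variable {M : Type*} [AddCommGroup M] [Module k M] [Module (MvPolynomial σ k) M]
  [IsScalarTower k (MvPolynomial σ k) M]

/-- The differential of the Koszul complex `⋀ W ⊗ M`, where `W` is the vector space with basis the
variables `x_i`, `i : σ`. A chain is written as a function `c : Finset σ → M`; the value `c T` is
the coefficient of `x_{t₁} ∧ ⋯ ∧ x_{tₚ}`, where `T = {t₁ < ⋯ < tₚ}`. The coefficient of `∂ c` at `T`
is the sum over `i ∉ T` of `± x_i • c (T ∪ {i})`, the sign being `-1` to the number of elements
of `T` below `i`. -/
def koszulDiff : (Finset σ → M) →ₗ[k] (Finset σ → M) :=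
  LinearMap.pi fun T => ∑ i ∈ Tᶜ,
    ((-1 : k) ^ (T.filter (· < i)).card) •
      ((Algebra.lsmul k k M (X i : MvPolynomial σ k)).comp (LinearMap.proj (insert i T)))

/-- The Koszul complex is a complex. -/
theorem koszulDiff_koszulDiff (c : Finset σ → M) : koszulDiff k σ (koszulDiff k σ c) = 0 := by
  classical
  ext T
  simp only [koszulDiff, LinearMap.pi_apply, LinearMap.sum_apply,
    LinearMap.smul_apply, LinearMap.comp_apply, LinearMap.proj_apply,
    Algebra.lsmul_coe, Finset.smul_sum, Pi.zero_apply]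
  rw [Finset.sum_sigma']
  refine Finset.sum_involution (fun x _ => ⟨x.2, x.1⟩) ?_ ?_ ?_ ?_
  · rintro ⟨i, j⟩ h
    simp only [Finset.mem_sigma, Finset.mem_compl, Finset.mem_insert, not_or] at h
    obtain ⟨hi, hji, hj⟩ := h
    dsimp only
    rw [Finset.insert_comm j i T, smul_comm (X i : MvPolynomial σ k),
      smul_comm (X j : MvPolynomial σ k) ((-1 : k) ^ _), smul_smul ((-1:k)^_), smul_smul ((-1:k)^_),
      smul_smul (X i : MvPolynomial σ k), smul_smul (X j : MvPolynomial σ k),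
      mul_comm (X j) (X i), ← add_smul]
    rw [Finset.filter_insert, Finset.filter_insert]
    rcases lt_or_gt_of_ne hji with h | h
    · simp [h, h.not_gt, hj, Finset.card_insert_of_notMem, pow_succ]
      left
      ring
    · simp [h, h.not_gt, hi, Finset.card_insert_of_notMem, pow_succ]
      left
      ring
  · rintro ⟨i, j⟩ h _ h2
    simp at h h2; grind
  · rintro ⟨i, j⟩ h
    simp at h ⊢; grind
  · rintro ⟨i, j⟩ h; rfl

/-- The chains in `⋀ᵖ W ⊗ M_j`, which have homological degree `p` and internal degree `p + j`. -/
def koszulChains (𝓜 : ℕ → Submodule k M) (p j : ℕ) : Submodule k (Finset σ → M) where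
  carrier := {c | ∀ T, c T ∈ 𝓜 j ∧ (T.card ≠ p → c T = 0)}
  add_mem' := by
    intro a b ha hb T
    refine ⟨(𝓜 j).add_mem (ha T).1 (hb T).1, fun h => ?_⟩
    simp [(ha T).2 h, (hb T).2 h]
  zero_mem' := by
    intro T
    exact ⟨(𝓜 j).zero_mem, fun _ => rfl⟩
  smul_mem' := by
    intro c a ha T
    refine ⟨(𝓜 j).smul_mem c (ha T).1, fun h => ?_⟩
    simp [(ha T).2 h]

/-- The cycles of homological degree `p` and internal degree `p + j`. -/
def koszulCycles (𝓜 : ℕ → Submodule k M) (p j : ℕ) : Submodule k (Finset σ → M) :=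
  koszulChains k σ 𝓜 p j ⊓ LinearMap.ker (koszulDiff k σ)

/-- The boundaries of homological degree `p` and internal degree `p + j`: the image of
`⋀ᵖ⁺¹ W ⊗ M_{j-1}`, which is zero for `j = 0`. -/
def koszulBoundaries (𝓜 : ℕ → Submodule k M) (p : ℕ) : ℕ → Submodule k (Finset σ → M)
  | 0 => ⊥
  | j + 1 => (koszulChains k σ 𝓜 (p + 1) j).map (koszulDiff k σ)

/-- `Tor_i^S(M, k)_{i+j}` for `S = k[x_i : i ∈ σ]` and a graded `S`-module `M` with homogeneous
pieces `𝓜 j`, `j ≥ 0`: the homology of `P ⊗ M`, where `P` is the Koszul complex on the variables,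
that is, the graded minimal free resolution of `k` over `S`. -/
abbrev GradedTor (𝓜 : ℕ → Submodule k M) (i j : ℕ) : Type _ :=
  koszulCycles k σ 𝓜 i j ⧸
    (koszulBoundaries k σ 𝓜 i j).submoduleOf (koszulCycles k σ 𝓜 i j)

/-- The graded Betti number `β^S_{i,j}(M) = dim_k Tor_i^S(M, k)_{i+j}`, `S = k[x_i : i ∈ σ]`. -/
def gradedBetti (𝓜 : ℕ → Submodule k M) (i j : ℕ) : ℕ :=
  Module.finrank k (GradedTor k σ 𝓜 i j)

/-- Property `N^S_{d,a}`: `β^S_{i,j}(M) = 0` for all `0 ≤ i ≤ a` and `j ≥ d`. -/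
def PropertyN (𝓜 : ℕ → Submodule k M) (d a : ℕ) : Prop :=
  ∀ i ≤ a, ∀ j ≥ d, gradedBetti k σ 𝓜 i j = 0

/-- `r` is the regularity `max {j | β^S_{i,j}(M) ≠ 0 for some i}`. -/
def IsRegularity (𝓜 : ℕ → Submodule k M) (r : ℕ) : Prop :=
  IsGreatest {j | ∃ i, gradedBetti k σ 𝓜 i j ≠ 0} r

end Koszul

/-! ### Projective algebraic sets -/

section AlgebraicSets

variable {k σ : Type*} [Field k]

/-- The common zero set in projective space of a family of homogeneous polynomials. -/
def IsAlgebraicSet (Y : Set (ℙ k (σ → k))) : Prop :=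
  ∃ F : Set (MvPolynomial σ k), (∀ f ∈ F, ∃ m, f.IsHomogeneous m) ∧
    Y = {p | ∀ f ∈ F, eval p.rep f = 0}

/-- Open subsets in the Zariski topology. -/
def IsZariskiOpen (U : Set (ℙ k (σ → k))) : Prop := IsAlgebraicSet Uᶜ

/-- The set of all nonzero vectors that represent a point of `W`. -/
def cone (W : Set (ℙ k (σ → k))) : Set (σ → k) :=
  {v | ∃ hv : v ≠ 0, Projectivization.mk k v hv ∈ W}

theorem cone_mono {W W' : Set (ℙ k (σ → k))} (h : W ⊆ W') : cone W ⊆ cone W' :=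
  fun _ hv => ⟨hv.1, h hv.2⟩

/-- The homogeneous ideal `I_Y`: all polynomials that vanish on the cone over `Y`. -/
def vanishingIdeal (Y : Set (ℙ k (σ → k))) : Ideal (MvPolynomial σ k) where
  carrier := {f | ∀ v ∈ cone Y, eval v f = 0}
  add_mem' := by
    intro f g hf hg v hv
    simp [hf v hv, hg v hv]
  zero_mem' := by
    intro v _
    simp
  smul_mem' := by
    intro c f hf v hv
    simp [hf v hv]

/-- No nonzero linear form vanishes on `Y`, i.e. `Y` lies in no hyperplane. -/
def IsNondegenerate (Y : Set (ℙ k (σ → k))) : Prop :=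
  ∀ l : MvPolynomial σ k, l.IsHomogeneous 1 → l ∈ vanishingIdeal Y → l = 0

/-- The homogeneous coordinate ring `R / I_Y`. -/
def CoordRing (Y : Set (ℙ k (σ → k))) : Type _ :=
  MvPolynomial σ k ⧸ vanishingIdeal Y

instance (Y : Set (ℙ k (σ → k))) : CommRing (CoordRing Y) :=
  inferInstanceAs (CommRing (MvPolynomial σ k ⧸ vanishingIdeal Y))

instance (Y : Set (ℙ k (σ → k))) : Algebra k (CoordRing Y) :=
  inferInstanceAs (Algebra k (MvPolynomial σ k ⧸ vanishingIdeal Y))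

/-- The quotient map `R → R / I_Y`. -/
def coordMap (Y : Set (ℙ k (σ → k))) : MvPolynomial σ k →ₐ[k] CoordRing Y :=
  Ideal.Quotient.mkₐ k (vanishingIdeal Y)

instance coordAlgebra (Y : Set (ℙ k (σ → k))) : Algebra (MvPolynomial σ k) (CoordRing Y) :=
  (coordMap Y).toRingHom.toAlgebra

instance (Y : Set (ℙ k (σ → k))) : Module (MvPolynomial σ k) (CoordRing Y) :=
  Algebra.toModule

instance (Y : Set (ℙ k (σ → k))) : IsScalarTower k (MvPolynomial σ k) (CoordRing Y) :=
  IsScalarTower.of_algebraMap_eq fun c => ((coordMap Y).commutes c).symm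

/-- `dim Y = n`, i.e. the homogeneous coordinate ring has Krull dimension `n + 1`. -/
def HasDim (Y : Set (ℙ k (σ → k))) (n : ℕ) : Prop :=
  ringKrullDim (CoordRing Y) = ((n + 1 : ℕ) : WithBot ℕ∞)

/-- The homogeneous pieces of the homogeneous coordinate ring. -/
def coordPiece (Y : Set (ℙ k (σ → k))) (m : ℕ) : Submodule k (CoordRing Y) :=
  (homogeneousSubmodule σ k m).map (coordMap Y).toLinearMap

/-- The homogeneous pieces of the homogeneous ideal `I_Y`. -/
def idealPiece (Y : Set (ℙ k (σ → k))) (m : ℕ) : Submodule k (vanishingIdeal Y) :=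
  (homogeneousSubmodule σ k m).comap ((vanishingIdeal Y).subtype.restrictScalars k)

/-- `Y` is arithmetically Cohen-Macaulay: the depth of the homogeneous coordinate ring (the length
of a regular sequence in the irrelevant maximal ideal) reaches its dimension. -/
def IsArithmeticallyCM (Y : Set (ℙ k (σ → k))) : Prop :=
  ∃ rs : List (CoordRing Y),
    (∀ r ∈ rs, r ∈ Ideal.span (Set.range fun i : σ => coordMap Y (X i))) ∧
    RingTheory.Sequence.IsRegular (CoordRing Y) rs ∧
    ringKrullDim (CoordRing Y) = (rs.length : WithBot ℕ∞)

end AlgebraicSets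

/-! ### Regular functions and twists of the structure sheaf -/

section Sections

variable {k σ : Type*} [Field k]

/-- A function on the cone over the locally closed set `W` is a section of `𝒪_W(m)` if it is
locally a quotient `f / g` of homogeneous polynomials with `deg f = deg g + m`. -/
def IsTwistedSection (W : Set (ℙ k (σ → k))) (m : ℤ) (s : cone W → k) : Prop :=
  ∀ v : cone W, ∃ (a b : ℕ) (f g : MvPolynomial σ k), f.IsHomogeneous a ∧ g.IsHomogeneous b ∧
    (a : ℤ) = b + m ∧ eval (v : σ → k) g ≠ 0 ∧
    ∀ w : cone W, eval (w : σ → k) g ≠ 0 → s w = eval (w : σ → k) f / eval (w : σ → k) g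

variable {W W' : Set (ℙ k (σ → k))}

theorem IsTwistedSection.zero (m : ℤ) : IsTwistedSection W m 0 := by
  intro v
  by_cases hm : 0 ≤ m
  · refine ⟨m.toNat, 0, 0, 1, isHomogeneous_zero _ _ _, isHomogeneous_one _ _, ?_, by simp,
      fun w _ => by simp⟩
    simp [hm]
  · obtain ⟨i, hi⟩ := Function.ne_iff.1 v.2.1
    refine ⟨0, (-m).toNat, 0, X i ^ (-m).toNat, isHomogeneous_zero _ _ _, ?_, ?_, ?_,
      fun w _ => by simp⟩
    · simpa using (isHomogeneous_X k i).pow (-m).toNat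
    · push_cast
      omega
    · rw [map_pow, eval_X]
      exact pow_ne_zero _ hi

theorem IsTwistedSection.add {m : ℤ} {s t : cone W → k} (hs : IsTwistedSection W m s)
    (ht : IsTwistedSection W m t) : IsTwistedSection W m (s + t) := by
  intro v
  obtain ⟨a, b, f, g, hf, hg, hab, hv, h⟩ := hs v
  obtain ⟨a', b', f', g', hf', hg', hab', hv', h'⟩ := ht v
  refine ⟨a + b', b + b', f * g' + g * f', g * g', (hf.mul hg').add ?_, hg.mul hg', ?_, ?_, ?_⟩
  · have : a + b' = b + a' := by omega
    rw [this]
    exact hg.mul hf'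
  · push_cast
    omega
  · simpa using ⟨hv, hv'⟩
  · intro w hw
    simp only [map_mul, ne_eq, mul_eq_zero, not_or] at hw
    simp only [Pi.add_apply, h w hw.1, h' w hw.2, map_add, map_mul]
    exact div_add_div _ _ hw.1 hw.2

theorem IsTwistedSection.mul {m m' : ℤ} {s t : cone W → k} (hs : IsTwistedSection W m s)
    (ht : IsTwistedSection W m' t) : IsTwistedSection W (m + m') (s * t) := by
  intro v
  obtain ⟨a, b, f, g, hf, hg, hab, hv, h⟩ := hs v
  obtain ⟨a', b', f', g', hf', hg', hab', hv', h'⟩ := ht v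
  refine ⟨a + a', b + b', f * f', g * g', hf.mul hf', hg.mul hg', ?_, ?_, ?_⟩
  · push_cast
    omega
  · simpa using ⟨hv, hv'⟩
  · intro w hw
    simp only [map_mul, ne_eq, mul_eq_zero, not_or] at hw
    simp only [Pi.mul_apply, h w hw.1, h' w hw.2, map_mul]
    exact div_mul_div_comm _ _ _ _

theorem IsTwistedSection.const (c : k) : IsTwistedSection W 0 (fun _ => c) := by
  intro v
  exact ⟨0, 0, C c, 1, isHomogeneous_C _ _, isHomogeneous_one _ _, by simp, by simp,
    fun w _ => by simp⟩

theorem IsTwistedSection.restrict {m : ℤ} (h : W ⊆ W') {s : cone W' → k}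
    (hs : IsTwistedSection W' m s) :
    IsTwistedSection W m (fun v => s (Set.inclusion (cone_mono h) v)) := by
  intro v
  obtain ⟨a, b, f, g, hf, hg, hab, hv, hs'⟩ := hs (Set.inclusion (cone_mono h) v)
  exact ⟨a, b, f, g, hf, hg, hab, hv, fun w hw => hs' (Set.inclusion (cone_mono h) w) hw⟩

/-- The ring `𝒪(W)` of regular functions on a locally closed set `W`. -/
def regularFunctions (W : Set (ℙ k (σ → k))) : Subalgebra k (cone W → k) where
  carrier := {s | IsTwistedSection W 0 s}
  mul_mem' := by
    intro s t hs ht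
    simpa using IsTwistedSection.mul hs ht
  add_mem' := fun hs ht => IsTwistedSection.add hs ht
  algebraMap_mem' := fun c => IsTwistedSection.const c

/-- The `𝒪(W)`-module of sections of `𝒪(m)` on `W`. -/
def twistedSections (W : Set (ℙ k (σ → k))) (m : ℤ) :
    Submodule (regularFunctions W) (cone W → k) where
  carrier := {s | IsTwistedSection W m s}
  add_mem' := fun hs ht => IsTwistedSection.add hs ht
  zero_mem' := IsTwistedSection.zero m
  smul_mem' := by
    intro r s hs
    have := IsTwistedSection.mul r.2 hs
    rwa [zero_add] at this

instance (W : Set (ℙ k (σ → k))) (m : ℤ) : Module (regularFunctions W) (twistedSections W m) :=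
  (twistedSections W m).module

instance (W : Set (ℙ k (σ → k))) (m : ℤ) : SMul (regularFunctions W) (twistedSections W m) :=
  (twistedSections W m).module.toSMul

/-- Restriction of regular functions. -/
def restrictFunction (h : W ⊆ W') (r : regularFunctions W') : regularFunctions W :=
  ⟨fun v => r.1 (Set.inclusion (cone_mono h) v), IsTwistedSection.restrict h r.2⟩

/-- Restriction of sections of `𝒪(m)`. -/
def restrictSection {m : ℤ} (h : W ⊆ W') (s : twistedSections W' m) : twistedSections W m :=
  ⟨fun v => s.1 (Set.inclusion (cone_mono h) v), IsTwistedSection.restrict h s.2⟩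

end Sections

/-! ### The subrings `S_t` and the projection from a coordinate subspace -/

section Projection

variable {k : Type*} [Field k] {N : ℕ}

/-- The indices of the variables `x_t, …, x_{N-1}` among `x_0, …, x_{N-1}`. -/
abbrev TailVar (N t : ℕ) : Type := {i : Fin N // t ≤ (i : ℕ)}

/-- The polynomial ring `S_t = k[x_t, …, x_{N-1}]`. -/
abbrev TailRing (k : Type*) [Field k] (N t : ℕ) : Type _ := MvPolynomial (TailVar N t) k

/-- `R / I_Y` as an algebra, hence as a module, over `S_t` through the inclusion `S_t ⊆ R`. -/
instance tailAlgebra (Y : Set (ℙ k (Fin N → k))) (t : ℕ) :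
    Algebra (TailRing k N t) (CoordRing Y) :=
  ((coordMap Y).comp (rename (Subtype.val : TailVar N t → Fin N))).toRingHom.toAlgebra

instance (Y : Set (ℙ k (Fin N → k))) (t : ℕ) : Module (TailRing k N t) (CoordRing Y) :=
  Algebra.toModule

instance (Y : Set (ℙ k (Fin N → k))) (t : ℕ) :
    IsScalarTower k (TailRing k N t) (CoordRing Y) :=
  IsScalarTower.of_algebraMap_eq fun c =>
    (((coordMap Y).comp (rename (Subtype.val : TailVar N t → Fin N))).commutes c).symm

/-- The linear subspace `x_t = ⋯ = x_{N-1} = 0`, with homogeneous coordinates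
`x_0, …, x_{t-1}`. -/
def coordSubspace (k : Type*) [Field k] (N t : ℕ) : Set (ℙ k (Fin N → k)) :=
  {p | ∀ i : TailVar N t, p.rep i = 0}

/-- The projection `[x_0 : ⋯ : x_{N-1}] ↦ [x_t : ⋯ : x_{N-1}]` from that subspace. -/
def linearProjection (t : ℕ) (p : ℙ k (Fin N → k)) (hp : p ∉ coordSubspace k N t) :
    ℙ k (TailVar N t → k) :=
  Projectivization.mk k (fun i : TailVar N t => p.rep i) fun h => hp fun i => congrFun h i

/-- The preimage of `U` in `Y` under the projection; it is meant for a set `Y` that does not meet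
the centre of the projection. -/
def projPreimage (Y : Set (ℙ k (Fin N → k))) (t : ℕ) (U : Set (ℙ k (TailVar N t → k))) :
    Set (ℙ k (Fin N → k)) :=
  {p | p ∈ Y ∧ ∃ hp : p ∉ coordSubspace k N t, linearProjection t p hp ∈ U}

theorem projPreimage_mono (Y : Set (ℙ k (Fin N → k))) (t : ℕ)
    {U U' : Set (ℙ k (TailVar N t → k))} (h : U ⊆ U') :
    projPreimage Y t U ⊆ projPreimage Y t U' :=
  fun _ hp => ⟨hp.1, hp.2.1, h hp.2.2⟩

theorem tail_mem_cone {Y : Set (ℙ k (Fin N → k))} {t : ℕ} {U : Set (ℙ k (TailVar N t → k))}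
    {v : Fin N → k} (hv : v ∈ cone (projPreimage Y t U)) :
    (fun i : TailVar N t => v i) ∈ cone U := by
  obtain ⟨hv0, -, hp, hU⟩ := hv
  obtain ⟨a, ha⟩ := Projectivization.exists_smul_eq_mk_rep k v hv0
  have key : ∀ i, (Projectivization.mk k v hv0).rep i = (a : k) * v i := fun i => by
    rw [← ha]
    rfl
  have h0 : (fun i : TailVar N t => v i) ≠ 0 := fun h => hp fun i => by
    rw [key, show v i = 0 from congrFun h i, mul_zero]
  refine ⟨h0, ?_⟩
  have : Projectivization.mk k (fun i : TailVar N t => v i) h0 = linearProjection t _ hp := by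
    symm
    unfold linearProjection
    rw [Projectivization.mk_eq_mk_iff']
    exact ⟨a, funext fun i => (key i).symm⟩
  rw [this]
  exact hU

/-- Pullback of a regular function on `U` along the projection `π : Y → ℙ`. -/
def pullback (Y : Set (ℙ k (Fin N → k))) (t : ℕ) {U : Set (ℙ k (TailVar N t → k))}
    (r : regularFunctions U) : regularFunctions (projPreimage Y t U) :=
  ⟨fun v => r.1 ⟨fun i => v.1 i, tail_mem_cone v.2⟩, by
    intro v
    obtain ⟨a, b, f, g, hf, hg, hab, hv, h⟩ := r.2 ⟨fun i => v.1 i, tail_mem_cone v.2⟩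
    refine ⟨a, b, rename Subtype.val f, rename Subtype.val g, hf.rename_isHomogeneous,
      hg.rename_isHomogeneous, hab, ?_, ?_⟩
    · rw [eval_rename]
      exact hv
    · intro w hw
      rw [eval_rename] at hw
      rw [eval_rename, eval_rename]
      exact h ⟨fun i => w.1 i, tail_mem_cone w.2⟩ hw⟩

/-- The homogeneous piece `S(-j)_m = S_{m-j}` of the shifted module `S(-j)`. -/
def shiftedPiece (k σ : Type*) [Field k] (j m : ℕ) : Submodule k (MvPolynomial σ k) :=
  if j ≤ m then homogeneousSubmodule σ k (m - j) else ⊥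

/-- `R / I_Y ≅ ⨁_{j < r} S_t(-j)^{b j}` as graded `S_t`-modules. -/
def GradedSplitting (Y : Set (ℙ k (Fin N → k))) (t r : ℕ) (b : ℕ → ℕ) : Prop :=
  ∃ Φ : ((j : Fin r) → Fin (b j) → TailRing k N t) ≃ₗ[TailRing k N t] CoordRing Y,
    ∀ m y, (∀ (j : Fin r) (l : Fin (b j)), y j l ∈ shiftedPiece k (TailVar N t) j m) ↔
      Φ y ∈ coordPiece Y m

/-- An isomorphism `⨁_{j < r} 𝒪(-j)^{b j} ≅ π_* 𝒪_Y` of sheaves of `𝒪`-modules on the target of the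
projection `π`, given by its components on the Zariski open sets. -/
structure SheafSplitting (Y : Set (ℙ k (Fin N → k))) (t r : ℕ) (b : ℕ → ℕ) where
  iso : ∀ U : Set (ℙ k (TailVar N t → k)), IsZariskiOpen U →
    ((j : Fin r) → Fin (b j) → twistedSections U (-((j : ℕ) : ℤ))) ≃+
      regularFunctions (projPreimage Y t U)
  map_smul : ∀ (U : Set (ℙ k (TailVar N t → k))) (hU : IsZariskiOpen U) (ρ : regularFunctions U)
    (s : (j : Fin r) → Fin (b j) → twistedSections U (-((j : ℕ) : ℤ))),
    iso U hU (fun j l => ρ • s j l) = pullback Y t ρ * iso U hU s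
  map_restrict : ∀ (U V : Set (ℙ k (TailVar N t → k))) (hU : IsZariskiOpen U)
    (hV : IsZariskiOpen V) (hVU : V ⊆ U)
    (s : (j : Fin r) → Fin (b j) → twistedSections U (-((j : ℕ) : ℤ))),
    iso V hV (fun j l => restrictSection hVU (s j l)) =
      restrictFunction (projPreimage_mono Y t hVU) (iso U hU s)

end Projection

end ProjSyz

end

open ProjSyz

/-! Write `A` for `R / I_X`. Betti numbers are read off Koszul complexes, and everything rests on
dropping the variables one at a time. The Koszul complex of `A` over `S_t` is the mapping cone of
multiplication by `x_t` on the one over `S_{t+1}`. With `T^t_{p,j}` for `Tor_p^{S_t}(A, k)_{p+j}`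
this gives exactness of `T^t_{p+1,j} → T^{t+1}_{p,j} → T^{t+1}_{p,j+1}`, where the second arrow is
multiplication by `x_t`.

For (a), vanishing of the left term for `j ≥ d` makes `x_t` injective on the strands `j ≥ d` over
`S_{t+1}`. Since `X` misses `Λ`, the Nullstellensatz makes every `x_i` nilpotent modulo the ideal
`(x_α, …)` of `A`; such an ideal kills Koszul homology, so `x_t` is also nilpotent there and these
strands vanish. Each dropped variable costs one homological degree: `N_{d,α}` over `R` becomes
`N_{d,α-t}` over `S_t` (`torVanishes_tail`). For (b)(ii), take `j = d - 1`: the right term vanishes,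
so the first arrow is onto (`IsLeastExtension.gradedBetti_le`). Part (b)(i) counts monomials in
`x_0, …, x_{α-1}` modulo the other variables.

For (c), `S_e` has `n + 1 = dim A` variables. If `A` is free, they form a regular sequence on `A`.
Conversely, a regular sequence of length `n + 1` kills all higher Koszul homology over `S_e`
(`koszulExact_of_isWeaklyRegular`); then minimal homogeneous generators are a basis by Nakayama
(`generatorMap_injective`). If `s` is the top degree of a generator, all strands beyond `s` vanish
over `S_e`, hence over `R`, while the comparison of Betti numbers carries the generators of degree
`s` to a nonzero `Tor_e^R(A, k)_{e+s}`. The shift between the Tor of `A` and of `I_X` gives `r = s +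
1`.

For the sheaf statement, a regular function on the preimage of a basic open set `h ≠ 0` becomes a
form after multiplication by a power of `h`; this form is expanded in the graded basis. The
coefficients are unique, so the local expansions glue. -/

noncomputable section

namespace ProjSyz

open MvPolynomial

set_option linter.unusedSectionVars false

/-! ### The Koszul differential of a family of ring elements -/

section KoszulFamily

variable {A σ N : Type*} [CommRing A] [Fintype σ] [LinearOrder σ] [AddCommGroup N] [Module A N]

/-- The Koszul differential on an `A`-module attached to a finite family of elements of `A`, with
the conventions of `koszulDiff`. -/
def familyDiff (x : σ → A) : (Finset σ → N) →ₗ[A] (Finset σ → N) :=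
  LinearMap.pi fun T => ∑ i ∈ Tᶜ,
    ((-1 : A) ^ (T.filter (· < i)).card) • (x i • LinearMap.proj (insert i T))

theorem familyDiff_apply (x : σ → A) (c : Finset σ → N) (T : Finset σ) :
    familyDiff x c T = ∑ i ∈ Tᶜ, ((-1 : A) ^ (T.filter (· < i)).card) • (x i • c (insert i T)) := by
  simp [familyDiff]

theorem neg_one_pow_smul_eq {k B P : Type*} [Ring k] [Ring B] [AddCommGroup P] [Module k P]
    [Module B P] (n : ℕ) (m : P) : ((-1 : k) ^ n) • m = ((-1 : B) ^ n) • m := by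
  rcases n.even_or_odd with h | h <;> simp [h.neg_one_pow]

theorem koszulDiff_apply {k : Type*} [Field k] [Module k N] [Module (MvPolynomial σ k) N]
    [IsScalarTower k (MvPolynomial σ k) N] (c : Finset σ → N) (T : Finset σ) :
    koszulDiff k σ c T = ∑ i ∈ Tᶜ, ((-1 : k) ^ (T.filter (· < i)).card) •
      ((X i : MvPolynomial σ k) • c (insert i T)) := by
  simp [koszulDiff]

/-- Only the action of the variables enters the differential, so the complex of the coordinate ring
over `S_t` can be treated as linear over the coordinate ring itself. This lets variables outside
`S_t` act on its homology. -/
theorem koszulDiff_eq_familyDiff {k : Type*} [Field k] [Module k N] [Module (MvPolynomial σ k) N]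
    [IsScalarTower k (MvPolynomial σ k) N] {x : σ → A}
    (h : ∀ i (m : N), (X i : MvPolynomial σ k) • m = x i • m) (c : Finset σ → N) :
    koszulDiff k σ c = familyDiff x c := by
  ext T
  rw [koszulDiff_apply, familyDiff_apply]
  exact Finset.sum_congr rfl fun i _ => by rw [h, neg_one_pow_smul_eq (B := A)]

/-- The terms indexed by `(i, j)` and `(j, i)` cancel: inserting the smaller index first contributes
one extra sign. -/
theorem familyDiff_familyDiff (x : σ → A) (c : Finset σ → N) :
    familyDiff x (familyDiff x c) = 0 := by
  classical
  ext T
  simp only [familyDiff_apply, Finset.smul_sum, Pi.zero_apply]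
  rw [Finset.sum_sigma']
  refine Finset.sum_involution (fun x _ => ⟨x.2, x.1⟩) ?_ ?_ ?_ ?_
  · rintro ⟨i, j⟩ h
    simp only [Finset.mem_sigma, Finset.mem_compl, Finset.mem_insert, not_or] at h
    obtain ⟨hi, hji, hj⟩ := h
    dsimp only
    rw [Finset.insert_comm j i T]
    simp only [smul_smul]
    rw [← add_smul, Finset.filter_insert, Finset.filter_insert]
    convert zero_smul A _
    rcases lt_or_gt_of_ne hji with h | h
    · simp only [h, h.not_gt, if_true, if_false]
      rw [Finset.card_insert_of_notMem (by simp [hj])]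
      ring
    · simp only [h, h.not_gt, if_true, if_false]
      rw [Finset.card_insert_of_notMem (by simp [hi])]
      ring
  · rintro ⟨i, j⟩ h _ h2
    simp at h h2; grind
  · rintro ⟨i, j⟩ h
    simp at h ⊢; grind
  · rintro ⟨i, j⟩ h; rfl

/-- Exterior multiplication by the basis vector `a`, up to sign. -/
def wedge (A : Type*) [CommRing A] [Module A N] (a : σ) (c : Finset σ → N) : Finset σ → N :=
  fun T => if a ∈ T then (-1 : A) ^ (T.filter (· < a)).card • c (T.erase a) else 0

/-- Exterior multiplication is a contracting homotopy for multiplication by `x a`. -/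
theorem familyDiff_wedge (x : σ → A) (a : σ) (c : Finset σ → N) :
    familyDiff x (wedge A a c) + wedge A a (familyDiff x c) = x a • c := by
  classical
  ext T
  simp only [Pi.add_apply, Pi.smul_apply, familyDiff_apply, wedge]
  by_cases ha : a ∈ T
  · rw [if_pos ha]
    have hcompl : (T.erase a)ᶜ = insert a Tᶜ := by
      ext i; by_cases hi : i = a <;> simp [hi]
    rw [hcompl, Finset.sum_insert (by simpa using ha), smul_add, Finset.insert_erase ha,
      Finset.filter_erase, Finset.erase_eq_of_notMem (by simp), smul_smul, ← mul_pow,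
      neg_one_mul, neg_neg, one_pow, one_smul, add_left_comm, Finset.smul_sum,
      ← Finset.sum_add_distrib]
    conv_rhs => rw [← add_zero (x a • c T)]
    congr 1
    refine Finset.sum_eq_zero fun i hi => ?_
    have hiT : i ∉ T := by simpa using hi
    have hia : i ≠ a := fun h => hiT (h ▸ ha)
    rw [if_pos (by simp [ha]), Finset.erase_insert_of_ne hia, Finset.filter_insert,
      Finset.filter_erase]
    simp only [smul_smul]
    rw [← add_smul]
    convert zero_smul A _
    rcases lt_or_gt_of_ne hia with h | h
    · rw [if_pos h, Finset.card_insert_of_notMem (by simp [hiT]),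
        Finset.erase_eq_of_notMem (by simp [h.not_gt])]
      ring
    · have hm : a ∈ T.filter (· < i) := by simp [ha, h]
      have := Finset.card_erase_add_one hm
      rw [if_neg h.not_gt, ← this]
      ring
  · rw [if_neg ha, add_zero, Finset.sum_eq_single a]
    · rw [if_pos (by simp), Finset.erase_insert ha, Finset.filter_insert, if_neg (lt_irrefl _),
        smul_smul, smul_smul, mul_right_comm, ← mul_pow, neg_one_mul, neg_neg, one_pow, one_mul]
    · intro i _ hi
      rw [if_neg, smul_zero, smul_zero]
      simp [ha, Ne.symm hi]
    · intro h
      simp [ha] at h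

/-- Elements of the ideal generated by the family annihilate Koszul homology. -/
theorem exists_familyDiff_eq_smul (x : σ → A) {z : Finset σ → N} (hz : familyDiff x z = 0) {r : A}
    (hr : r ∈ Ideal.span (Set.range x)) : ∃ w, familyDiff x w = r • z := by
  suffices h : Ideal.span (Set.range x) ≤
      (LinearMap.range (familyDiff (N := N) x)).comap (LinearMap.toSpanSingleton A _ z) by
    simpa using h hr
  rw [Ideal.span_le]
  rintro _ ⟨a, rfl⟩
  refine ⟨wedge A a z, ?_⟩
  have h := familyDiff_wedge x a z
  rw [hz] at h
  rw [LinearMap.toSpanSingleton_apply, ← h]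
  have : wedge A a (0 : Finset σ → N) = 0 := by ext T; simp [wedge]
  rw [this, add_zero]

/-- A chain of homological degree `p`. -/
def IsChain (p : ℕ) (c : Finset σ → N) : Prop := ∀ T, T.card ≠ p → c T = 0

/-- The part of homological degree `p` of a chain. -/
def chainPart (p : ℕ) (c : Finset σ → N) : Finset σ → N := fun T => if T.card = p then c T else 0

theorem isChain_chainPart (p : ℕ) (c : Finset σ → N) : IsChain p (chainPart p c) :=
  fun _ hT => if_neg hT

theorem familyDiff_chainPart (x : σ → A) (p : ℕ) (c : Finset σ → N) :
    familyDiff x (chainPart (p + 1) c) = chainPart p (familyDiff x c) := by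
  ext T
  simp only [familyDiff_apply, chainPart]
  split_ifs with h
  · refine Finset.sum_congr rfl fun i hi => ?_
    rw [if_pos]
    rw [Finset.card_insert_of_notMem (by simpa using hi), h]
  · refine Finset.sum_eq_zero fun i hi => ?_
    rw [if_neg, smul_zero, smul_zero]
    rw [Finset.card_insert_of_notMem (by simpa using hi)]
    omega

theorem IsChain.chainPart_eq {p : ℕ} {c : Finset σ → N} (h : IsChain p c) : chainPart p c = c := by
  ext T
  by_cases hT : T.card = p
  · simp [chainPart, hT]
  · simp [chainPart, hT, h T hT]

theorem familyDiff_comp {N' : Type*} [AddCommGroup N'] [Module A N'] (x : σ → A) (φ : N →ₗ[A] N')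
    (c : Finset σ → N) : familyDiff x (φ ∘ c) = φ ∘ familyDiff x c := by
  ext T
  simp [familyDiff_apply]

/-- The chain of homological degree one with prescribed coefficients. -/
def singleChain (g : σ → N) : Finset σ → N := fun T => ∑ i, if T = {i} then g i else 0

theorem singleChain_singleton (g : σ → N) (i : σ) : singleChain g {i} = g i := by
  simp [singleChain]

theorem isChain_singleChain (g : σ → N) : IsChain 1 (singleChain g) := by
  intro T hT
  refine Finset.sum_eq_zero fun i _ => if_neg ?_
  rintro rfl
  simp at hT

theorem familyDiff_empty (x : σ → A) (c : Finset σ → N) :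
    familyDiff x c ∅ = ∑ i, x i • c {i} := by
  simp [familyDiff_apply]

theorem familyDiff_apply_eq_zero (x : σ → A) {p : ℕ} {c : Finset σ → N} (hc : IsChain (p + 1) c)
    {T : Finset σ} (hT : T.card ≠ p) : familyDiff x c T = 0 := by
  rw [← hc.chainPart_eq, familyDiff_chainPart, chainPart, if_neg hT]

variable (N) in
/-- The Koszul homology of the family vanishes in homological degree `p`. -/
def KoszulExact (x : σ → A) (p : ℕ) : Prop :=
  ∀ z : Finset σ → N, IsChain p z → familyDiff x z = 0 → ∃ w, IsChain (p + 1) w ∧ familyDiff x w = z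

/-- The differential lowers homological degree by exactly one, so an arbitrary preimage may be
replaced by its part of degree `p + 1`. -/
theorem koszulExact_of_exists {x : σ → A} {p : ℕ}
    (h : ∀ z : Finset σ → N, IsChain p z → familyDiff x z = 0 → ∃ w, familyDiff x w = z) :
    KoszulExact N x p := by
  intro z hz hz0
  obtain ⟨w, rfl⟩ := h z hz hz0
  exact ⟨chainPart (p + 1) w, isChain_chainPart _ _, by rw [familyDiff_chainPart, hz.chainPart_eq]⟩

open scoped Pointwise in
/-- Depth sensitivity: a weakly regular sequence of length `q` whose members are nilpotent modulo
the family makes the Koszul homology vanish in degrees above `card σ - q`. -/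
theorem koszulExact_of_isWeaklyRegular {A σ : Type*} [CommRing A] [Fintype σ] [LinearOrder σ]
    (x : σ → A) (rs : List A) :
    ∀ {N : Type*} [AddCommGroup N] [Module A N],
      (∀ r ∈ rs, r ∈ (Ideal.span (Set.range x)).radical) →
      RingTheory.Sequence.IsWeaklyRegular N rs → ∀ p, Fintype.card σ < p + rs.length →
      KoszulExact N x p := by
  induction rs with
  | nil =>
    intro N _ _ _ _ p hp z hz _
    refine ⟨0, fun _ _ => rfl, ?_⟩
    ext T
    rw [map_zero, hz T]
    · rfl
    · have := Finset.card_le_univ T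
      simp at hp
      omega
  | cons r rs ih =>
    intro N _ _ hrad hreg p hp
    rw [RingTheory.Sequence.isWeaklyRegular_cons_iff] at hreg
    -- The shorter sequence is used on `N / rN`, where vanishing starts one homological degree
    -- higher.
    have hq : KoszulExact (QuotSMulTop r N) x (p + 1) :=
      ih (fun s hs => hrad s (List.mem_cons_of_mem _ hs)) hreg.2 (p + 1)
        (by rw [List.length_cons] at hp; omega)
    let π : N →ₗ[A] QuotSMulTop r N := Submodule.mkQ _
    have hπ : Function.Surjective π := Submodule.mkQ_surjective _
    have hπd := familyDiff_comp x π
    -- Multiplication by `r` is injective on homology in degree `p`. If `r z = ∂w`, then `w` is a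
    -- cycle modulo `r`, hence `w = ∂u' + r y`; so `r ∂y = r z`, and `r` cancels because it is
    -- regular on `N`.
    have key : ∀ z : Finset σ → N, familyDiff x z = 0 → IsChain p z →
        (∃ w, familyDiff x w = r • z) → ∃ w, familyDiff x w = z := by
      rintro z hz0 hz ⟨w, hw⟩
      set w' := chainPart (p + 1) w with hw'
      have hw1 : familyDiff x w' = r • z := by
        rw [familyDiff_chainPart, hw, IsChain.chainPart_eq]
        intro T hT
        simp [hz T hT]
      obtain ⟨u, -, hu⟩ := hq (π ∘ w') (fun T hT => by
        rw [Function.comp_apply, hw', isChain_chainPart _ _ T hT, map_zero]) (by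
        rw [hπd, hw1]
        ext T
        simp only [Function.comp_apply, Pi.smul_apply, Pi.zero_apply]
        exact (Submodule.Quotient.mk_eq_zero _).2
          (Submodule.smul_mem_pointwise_smul _ _ _ trivial))
      choose u' hu' using fun T => hπ (u T)
      have hu1 : π ∘ u' = u := funext hu'
      rw [← hu1, hπd] at hu
      have hex : ∀ T, ∃ y, r • y = w' T - familyDiff x u' T := by
        intro T
        have h : w' T - familyDiff x u' T ∈ r • (⊤ : Submodule A N) := by
          rw [← Submodule.Quotient.mk_eq_zero, Submodule.Quotient.mk_sub, sub_eq_zero]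
          exact (congrFun hu T).symm
        obtain ⟨y, -, hy⟩ := h
        exact ⟨y, hy⟩
      choose y hy using hex
      refine ⟨y, ?_⟩
      have hy' : r • y = w' - familyDiff x u' := funext hy
      have h1 : r • familyDiff x y = r • z := by
        rw [← map_smul, hy', map_sub, familyDiff_familyDiff, hw1, sub_zero]
      ext T
      exact hreg.1 (congrFun h1 T)
    refine koszulExact_of_exists fun z hz hz0 => ?_
    -- A power of `r` lies in the ideal of the family and so kills the class of `z`; injectivity
    -- then removes one factor of `r` at a time.
    obtain ⟨q, hq⟩ := hrad r List.mem_cons_self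
    have hbd : ∃ w, familyDiff x w = r ^ q • z := exists_familyDiff_eq_smul x hz0 hq
    clear hq
    induction q with
    | zero => simpa using hbd
    | succ q ihq =>
      refine ihq (key _ ?_ ?_ ?_)
      · rw [map_smul, hz0, smul_zero]
      · intro T hT
        simp [hz T hT]
      · rwa [smul_smul, ← pow_succ']

end KoszulFamily

/-! ### Vanishing of graded Betti numbers and the mapping cone -/

section MappingCone

variable {k σ σ' M : Type*} [Field k] [Fintype σ] [LinearOrder σ] [Fintype σ'] [LinearOrder σ']
  [AddCommGroup M] [Module k M]
  [Module (MvPolynomial σ k) M] [IsScalarTower k (MvPolynomial σ k) M]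
  [Module (MvPolynomial σ' k) M] [IsScalarTower k (MvPolynomial σ' k) M]
  {𝓜 : ℕ → Submodule k M}

theorem mem_koszulChains {p j : ℕ} {c : Finset σ → M} :
    c ∈ koszulChains k σ 𝓜 p j ↔ (∀ T, c T ∈ 𝓜 j) ∧ IsChain p c :=
  forall_and

theorem mem_koszulCycles {p j : ℕ} {c : Finset σ → M} :
    c ∈ koszulCycles k σ 𝓜 p j ↔ ((∀ T, c T ∈ 𝓜 j) ∧ IsChain p c) ∧ koszulDiff k σ c = 0 := by
  rw [koszulCycles, Submodule.mem_inf, mem_koszulChains, LinearMap.mem_ker]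

theorem mem_koszulBoundaries_succ {p j : ℕ} {c : Finset σ → M} :
    c ∈ koszulBoundaries k σ 𝓜 p (j + 1) ↔
      ∃ w, ((∀ T, w T ∈ 𝓜 j) ∧ IsChain (p + 1) w) ∧ koszulDiff k σ w = c := by
  simp only [koszulBoundaries, Submodule.mem_map, mem_koszulChains]

theorem mem_koszulBoundaries_zero {p : ℕ} {c : Finset σ → M} :
    c ∈ koszulBoundaries k σ 𝓜 p 0 ↔ c = 0 := by
  simp [koszulBoundaries]

variable (k σ 𝓜) in
/-- Every cycle of homological degree `p` and internal degree `p + j` is a boundary. -/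
def TorVanishes (p j : ℕ) : Prop := koszulCycles k σ 𝓜 p j ≤ koszulBoundaries k σ 𝓜 p j

theorem finite_koszulChains [∀ j, Module.Finite k (𝓜 j)] (p j : ℕ) :
    Module.Finite k (koszulChains k σ 𝓜 p j) := by
  let g : koszulChains k σ 𝓜 p j →ₗ[k] (Finset σ → 𝓜 j) :=
    LinearMap.pi fun T =>
      ((LinearMap.proj T).comp (koszulChains k σ 𝓜 p j).subtype).codRestrict (𝓜 j)
        fun c => (mem_koszulChains.1 c.2).1 T
  refine Module.Finite.of_injective g fun a b hab => ?_
  ext T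
  exact congrArg Subtype.val (congrFun hab T)

theorem finite_koszulCycles [∀ j, Module.Finite k (𝓜 j)] (p j : ℕ) :
    Module.Finite k (koszulCycles k σ 𝓜 p j) :=
  have := finite_koszulChains (k := k) (σ := σ) (𝓜 := 𝓜) p j
  Submodule.finiteDimensional_of_le inf_le_left

/-- Finiteness of the pieces matters because `finrank` is also zero on infinite-dimensional spaces.
-/
theorem gradedBetti_eq_zero_iff [∀ j, Module.Finite k (𝓜 j)] {p j : ℕ} :
    gradedBetti k σ 𝓜 p j = 0 ↔ TorVanishes k σ 𝓜 p j := by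
  have := finite_koszulCycles (k := k) (σ := σ) (𝓜 := 𝓜) p j
  rw [gradedBetti, Module.finrank_zero_iff, Submodule.Quotient.subsingleton_iff,
    Submodule.submoduleOf_eq_top]
  rfl

/-- The totally ordered set `σ` is obtained from `σ'` by adding the least element `i₀`. -/
structure IsLeastExtension (f : σ' ↪o σ) (i₀ : σ) : Prop where
  lt : ∀ a, i₀ < f a
  cover : ∀ b, b = i₀ ∨ ∃ a, f a = b

/-- The coefficients of a chain that do not involve `i₀`. -/
def lowPart (f : σ' ↪o σ) (c : Finset σ → M) : Finset σ' → M := fun T => c (T.map f.toEmbedding)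

/-- The coefficients of a chain that involve `i₀`. -/
def highPart (f : σ' ↪o σ) (i₀ : σ) (c : Finset σ → M) : Finset σ' → M :=
  fun T => c (insert i₀ (T.map f.toEmbedding))

/-- The chain with given coefficients off `i₀` and at `i₀`. -/
def joinParts (f : σ' ↪o σ) (i₀ : σ) (c₀ c₁ : Finset σ' → M) : Finset σ → M :=
  fun T => if i₀ ∈ T then c₁ (Finset.univ.filter (f · ∈ T)) else c₀ (Finset.univ.filter (f · ∈ T))

/-! ### Adding a least variable: the Koszul complex as a mapping cone -/

namespace IsLeastExtension

variable {f : σ' ↪o σ} {i₀ : σ} (h : IsLeastExtension f i₀)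
include h

theorem notMem_map (T : Finset σ') : i₀ ∉ T.map f.toEmbedding := by
  intro hm
  obtain ⟨a, -, ha⟩ := Finset.mem_map.1 hm
  exact (h.lt a).ne' ha

theorem lowPart_join (c₀ c₁ : Finset σ' → M) : lowPart f (joinParts f i₀ c₀ c₁) = c₀ := by
  ext T
  rw [lowPart, joinParts, if_neg (h.notMem_map T)]
  congr 1
  ext a
  simp

theorem highPart_join (c₀ c₁ : Finset σ' → M) : highPart f i₀ (joinParts f i₀ c₀ c₁) = c₁ := by
  ext T
  rw [highPart, joinParts, if_pos (Finset.mem_insert_self _ _)]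
  congr 1
  ext a
  simp [(h.lt a).ne']

theorem exists_map_eq (T : Finset σ) :
    ∃ T' : Finset σ', T = T'.map f.toEmbedding ∨ T = insert i₀ (T'.map f.toEmbedding) := by
  refine ⟨Finset.univ.filter (f · ∈ T), ?_⟩
  by_cases hi : i₀ ∈ T
  · right
    ext b
    rcases h.cover b with rfl | ⟨a, rfl⟩
    · simp [hi]
    · simp [(h.lt a).ne']
  · left
    ext b
    rcases h.cover b with rfl | ⟨a, rfl⟩
    · simp [hi, (h.lt _).ne']
    · simp

theorem forall_iff (P : Finset σ → Prop) :
    (∀ T, P T) ↔ (∀ T' : Finset σ', P (T'.map f.toEmbedding)) ∧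
      ∀ T' : Finset σ', P (insert i₀ (T'.map f.toEmbedding)) := by
  refine ⟨fun H => ⟨fun _ => H _, fun _ => H _⟩, fun H T => ?_⟩
  obtain ⟨T', rfl | rfl⟩ := h.exists_map_eq T
  exacts [H.1 T', H.2 T']

theorem parts_ext {c c' : Finset σ → M} (h0 : lowPart f c = lowPart f c')
    (h1 : highPart f i₀ c = highPart f i₀ c') : c = c' :=
  funext <| (h.forall_iff fun T => c T = c' T).2 ⟨congrFun h0, congrFun h1⟩

theorem card_insert_map (T : Finset σ') : (insert i₀ (T.map f.toEmbedding)).card = T.card + 1 := by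
  rw [Finset.card_insert_of_notMem (h.notMem_map T), Finset.card_map]

theorem mem_forall_join {P : Submodule k M} {c₀ c₁ : Finset σ' → M} (h0 : ∀ T, c₀ T ∈ P)
    (h1 : ∀ T, c₁ T ∈ P) (T : Finset σ) : joinParts f i₀ c₀ c₁ T ∈ P := by
  unfold joinParts
  split_ifs
  exacts [h1 _, h0 _]

theorem isChain_succ_iff {p : ℕ} {c : Finset σ → M} :
    IsChain (p + 1) c ↔ IsChain (p + 1) (lowPart f c) ∧ IsChain p (highPart f i₀ c) := by
  unfold IsChain
  rw [h.forall_iff]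
  simp only [Finset.card_map, h.card_insert_map, ne_eq, Nat.add_right_cancel_iff, lowPart, highPart]

theorem isChain_zero_iff {c : Finset σ → M} :
    IsChain 0 c ↔ IsChain 0 (lowPart f c) ∧ highPart f i₀ c = 0 := by
  unfold IsChain
  rw [h.forall_iff]
  simp [h.card_insert_map, lowPart, highPart, funext_iff]

variable (hact : ∀ a (m : M), (X (f a) : MvPolynomial σ k) • m = (X a : MvPolynomial σ' k) • m)
include hact

/-- First row of the mapping cone of multiplication by `X i₀`. As `i₀` is least, no index lies below
it and this term carries no sign. -/
theorem lowPart_koszulDiff (c : Finset σ → M) : lowPart f (koszulDiff k σ c) =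
    (fun T => (X i₀ : MvPolynomial σ k) • highPart f i₀ c T) + koszulDiff k σ' (lowPart f c) := by
  classical
  ext T
  have hc : (T.map f.toEmbedding)ᶜ = insert i₀ (Tᶜ.map f.toEmbedding) := by
    ext b
    rcases h.cover b with rfl | ⟨a, rfl⟩
    · simp [(h.lt _).ne']
    · simp [(h.lt a).ne']
  rw [lowPart, koszulDiff_apply, hc, Finset.sum_insert (h.notMem_map _), Finset.sum_map,
    Pi.add_apply, koszulDiff_apply]
  congr 1
  · rw [Finset.filter_false_of_mem, Finset.card_empty, pow_zero, one_smul, highPart]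
    intro b hb
    obtain ⟨a, -, rfl⟩ := Finset.mem_map.1 hb
    exact (h.lt a).not_gt
  · refine Finset.sum_congr rfl fun a _ => ?_
    have hf : ((T.map f.toEmbedding).filter (· < f.toEmbedding a)) =
        (T.filter (· < a)).map f.toEmbedding := by
      ext b
      rcases h.cover b with rfl | ⟨a, rfl⟩
      · simp [(h.lt _).ne']
      · simp
    change _ • (X (f a) : MvPolynomial σ k) • c _ = _
    rw [hf, Finset.card_map, hact, lowPart, Finset.map_insert]

/-- Second row of the mapping cone. As `i₀` lies below every other index, its presence in the set
flips every sign. -/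
theorem highPart_koszulDiff (c : Finset σ → M) :
    highPart f i₀ (koszulDiff k σ c) = -koszulDiff k σ' (highPart f i₀ c) := by
  classical
  ext T
  have hc : (insert i₀ (T.map f.toEmbedding))ᶜ = Tᶜ.map f.toEmbedding := by
    ext b
    rcases h.cover b with rfl | ⟨a, rfl⟩
    · simp [(h.lt _).ne']
    · simp [(h.lt a).ne']
  rw [highPart, koszulDiff_apply, hc, Finset.sum_map, Pi.neg_apply, koszulDiff_apply,
    ← Finset.sum_neg_distrib]
  refine Finset.sum_congr rfl fun a _ => ?_
  have hf : ((insert i₀ (T.map f.toEmbedding)).filter (· < f.toEmbedding a)) =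
      insert i₀ ((T.filter (· < a)).map f.toEmbedding) := by
    ext b
    rcases h.cover b with rfl | ⟨a', rfl⟩
    · simp [h.lt a]
    · simp [(h.lt a').ne']
  change _ • (X (f a) : MvPolynomial σ k) • c _ = _
  rw [hf, h.card_insert_map, hact, highPart, Finset.map_insert, Finset.insert_comm, pow_succ,
    mul_neg_one, neg_smul]

theorem koszulDiff_smul (c : Finset σ' → M) (r : MvPolynomial σ k) :
    koszulDiff k σ' (fun T => r • c T) = fun T => r • koszulDiff k σ' c T := by
  ext T
  rw [koszulDiff_apply, koszulDiff_apply, Finset.smul_sum]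
  refine Finset.sum_congr rfl fun a _ => ?_
  rw [← hact, ← hact, smul_comm r, smul_comm r]

/-- The cycle over `σ` made from a cycle `z` over `σ'` and a chain with boundary `X i₀ • z`. -/
theorem join_mem_koszulCycles {p j : ℕ} {z w : Finset σ' → M}
    (hz : z ∈ koszulCycles k σ' 𝓜 p j) (hw : w ∈ koszulChains k σ' 𝓜 (p + 1) j)
    (hwz : koszulDiff k σ' w = fun T => (X i₀ : MvPolynomial σ k) • z T) :
    joinParts f i₀ (-w) z ∈ koszulCycles k σ 𝓜 (p + 1) j := by
  rw [mem_koszulCycles] at hz ⊢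
  rw [mem_koszulChains] at hw
  refine ⟨⟨h.mem_forall_join (fun T => neg_mem (hw.1 T)) hz.1.1, h.isChain_succ_iff.2 ⟨?_, ?_⟩⟩, ?_⟩
  · rw [h.lowPart_join]
    intro T hT
    simp [hw.2 T hT]
  · rw [h.highPart_join]
    exact hz.1.2
  · refine h.parts_ext ?_ ?_
    · rw [h.lowPart_koszulDiff hact, h.lowPart_join, h.highPart_join, map_neg, hwz, add_neg_cancel]
      rfl
    · rw [h.highPart_koszulDiff hact, h.highPart_join, hz.2, neg_zero]
      rfl

/-- Together with the next lemma, this makes `highPart` induce the connecting map from `Tor_{p+1}`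
over `σ` to `Tor_p` over `σ'`. Removing `i₀` leaves the coefficients in `𝓜 j`, so the strand `j` is
preserved. -/
theorem highPart_mem_koszulCycles {p j : ℕ} {c : Finset σ → M}
    (hc : c ∈ koszulCycles k σ 𝓜 (p + 1) j) : highPart f i₀ c ∈ koszulCycles k σ' 𝓜 p j := by
  rw [mem_koszulCycles] at hc ⊢
  refine ⟨⟨fun T => hc.1.1 _, (h.isChain_succ_iff.1 hc.1.2).2⟩, ?_⟩
  have := h.highPart_koszulDiff hact c
  rw [hc.2] at this
  rw [← neg_eq_zero, ← this]
  rfl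

theorem highPart_mem_koszulBoundaries {p j : ℕ} {c : Finset σ → M}
    (hc : c ∈ koszulBoundaries k σ 𝓜 (p + 1) j) :
    highPart f i₀ c ∈ koszulBoundaries k σ' 𝓜 p j := by
  cases j with
  | zero =>
    rw [mem_koszulBoundaries_zero] at hc ⊢
    rw [hc]
    rfl
  | succ j =>
    rw [mem_koszulBoundaries_succ] at hc ⊢
    obtain ⟨w, ⟨hw, hwc⟩, rfl⟩ := hc
    refine ⟨-highPart f i₀ w, ⟨fun T => neg_mem (hw _), fun T hT => ?_⟩, ?_⟩
    · simp [(h.isChain_succ_iff.1 hwc).2 T hT]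
    · rw [h.highPart_koszulDiff hact, map_neg]

/-- Vanishing over `σ` in homological degree `p + 1` passes to `σ'` in homological degree `p`
if powers of `X i₀` annihilate the Koszul homology over `σ'`. -/
theorem torVanishes_of_succ {p d : ℕ} (hv : ∀ j ≥ d, TorVanishes k σ 𝓜 (p + 1) j)
    (hmul : ∀ j, ∀ m ∈ 𝓜 j, (X i₀ : MvPolynomial σ k) • m ∈ 𝓜 (j + 1))
    (hnil : ∀ j, ∀ z ∈ koszulCycles k σ' 𝓜 p j, ∃ q, (fun T => (X i₀ : MvPolynomial σ k) ^ q • z T) ∈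
      koszulBoundaries k σ' 𝓜 p (j + q)) :
    ∀ j ≥ d, TorVanishes k σ' 𝓜 p j := by
  -- Injectivity of `X i₀` on the strands `j ≥ d`: a class it kills is in the image of the
  -- connecting map, whose source vanishes.
  have key : ∀ j ≥ d, ∀ z ∈ koszulCycles k σ' 𝓜 p j,
      (fun T => (X i₀ : MvPolynomial σ k) • z T) ∈ koszulBoundaries k σ' 𝓜 p (j + 1) →
      z ∈ koszulBoundaries k σ' 𝓜 p j := by
    intro j hj z hz hb
    rw [mem_koszulBoundaries_succ] at hb
    obtain ⟨w, hw, hwz⟩ := hb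
    have := h.highPart_mem_koszulBoundaries hact
      (hv j hj (h.join_mem_koszulCycles hact hz (mem_koszulChains.2 hw) hwz))
    rwa [h.highPart_join] at this
  intro j hj z hz
  obtain ⟨q, hq⟩ := hnil j z hz
  induction q generalizing j z with
  | zero => simpa using hq
  | succ q ih =>
    have hz' := mem_koszulCycles.1 hz
    refine key j hj z hz (ih (j + 1) (by omega) (z := fun T => X i₀ • z T) (mem_koszulCycles.2
      ⟨⟨fun T => hmul j _ (hz'.1.1 T), fun T hT => ?_⟩, ?_⟩) ?_)
    · simp [hz'.1.2 T hT]
    · rw [h.koszulDiff_smul hact, hz'.2]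
      ext T
      simp
    · simp only [smul_smul, ← pow_succ]
      rwa [add_right_comm, add_assoc]

/-- The connecting map is onto when the next strand vanishes over `σ'`. -/
theorem gradedBetti_le [∀ j, Module.Finite k (𝓜 j)] {p j : ℕ}
    (hv : TorVanishes k σ' 𝓜 p (j + 1))
    (hmul : ∀ m ∈ 𝓜 j, (X i₀ : MvPolynomial σ k) • m ∈ 𝓜 (j + 1)) :
    gradedBetti k σ' 𝓜 p j ≤ gradedBetti k σ 𝓜 (p + 1) j := by
  have := finite_koszulCycles (k := k) (σ := σ) (𝓜 := 𝓜) (p + 1) j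
  let g : (Finset σ → M) →ₗ[k] (Finset σ' → M) :=
    LinearMap.pi fun T => LinearMap.proj (insert i₀ (T.map f.toEmbedding))
  let G : koszulCycles k σ 𝓜 (p + 1) j →ₗ[k] koszulCycles k σ' 𝓜 p j :=
    g.restrict fun c hc => h.highPart_mem_koszulCycles hact hc
  have hG : (koszulBoundaries k σ 𝓜 (p + 1) j).submoduleOf (koszulCycles k σ 𝓜 (p + 1) j) ≤
      ((koszulBoundaries k σ' 𝓜 p j).submoduleOf (koszulCycles k σ' 𝓜 p j)).comap G :=
    fun c hc => h.highPart_mem_koszulBoundaries hact hc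
  refine LinearMap.finrank_le_finrank_of_surjective (f := Submodule.mapQ _ _ G hG) ?_
  intro y
  obtain ⟨z, rfl⟩ := Submodule.mkQ_surjective _ y
  have hz := mem_koszulCycles.1 z.2
  -- The obstruction to lifting `z` through the connecting map is the class of `X i₀ • z`, which
  -- lives in the vanishing strand `j + 1`.
  have hb : (fun T => (X i₀ : MvPolynomial σ k) • z.1 T) ∈ koszulBoundaries k σ' 𝓜 p (j + 1) := by
    refine hv (mem_koszulCycles.2 ⟨⟨fun T => hmul _ (hz.1.1 T), fun T hT => ?_⟩, ?_⟩)
    · simp [hz.1.2 T hT]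
    · rw [h.koszulDiff_smul hact, hz.2]
      ext T
      simp
  obtain ⟨w, hw, hwz⟩ := mem_koszulBoundaries_succ.1 hb
  refine ⟨Submodule.Quotient.mk ⟨_, h.join_mem_koszulCycles hact z.2 (mem_koszulChains.2 hw) hwz⟩, ?_⟩
  rw [Submodule.mapQ_apply, Submodule.mkQ_apply]
  congr 1
  exact Subtype.ext (h.highPart_join _ _)

/-- Vanishing of a strand over `σ'` implies its vanishing over `σ`. -/
theorem torVanishes_of_torVanishes {j : ℕ} (hv : ∀ p, TorVanishes k σ' 𝓜 p (j + 1))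
    (hmul : ∀ m ∈ 𝓜 j, (X i₀ : MvPolynomial σ k) • m ∈ 𝓜 (j + 1)) (p : ℕ) :
    TorVanishes k σ 𝓜 p (j + 1) := by
  intro c hc
  have hc' := mem_koszulCycles.1 hc
  have hlow := h.lowPart_koszulDiff hact c
  -- The image of the class of `c` under the connecting map is zero; for `p = 0` there is no high
  -- part at all.
  have hw : ∃ w : Finset σ' → M, ((∀ T, w T ∈ 𝓜 j) ∧ IsChain p w) ∧
      koszulDiff k σ' w = highPart f i₀ c := by
    cases p with
    | zero =>
      refine ⟨0, ⟨fun T => zero_mem _, fun _ _ => rfl⟩, ?_⟩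
      rw [map_zero, (h.isChain_zero_iff.1 hc'.1.2).2]
    | succ p => exact mem_koszulBoundaries_succ.1 (hv p (h.highPart_mem_koszulCycles hact hc))
  obtain ⟨w, ⟨hw, hwc⟩, hwd⟩ := hw
  have hlc : IsChain p (lowPart f c) := by
    cases p with
    | zero => exact (h.isChain_zero_iff.1 hc'.1.2).1
    | succ p => exact (h.isChain_succ_iff.1 hc'.1.2).1
  -- Removing the high part changes `c` by the boundary of a chain built from `w`, and leaves this
  -- cycle over `σ'`.
  have hz : lowPart f c + (fun T => (X i₀ : MvPolynomial σ k) • w T) ∈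
      koszulCycles k σ' 𝓜 p (j + 1) := by
    refine mem_koszulCycles.2 ⟨⟨fun T => add_mem (hc'.1.1 _) (hmul _ (hw T)), fun T hT => ?_⟩, ?_⟩
    · simp [hlc T hT, hwc T hT]
    · rw [map_add, h.koszulDiff_smul hact, hwd, add_comm, ← hlow, hc'.2]
      rfl
  obtain ⟨u, ⟨hu, huc⟩, hud⟩ := mem_koszulBoundaries_succ.1 (hv p hz)
  refine mem_koszulBoundaries_succ.2 ⟨joinParts f i₀ u (-w),
    ⟨h.mem_forall_join hu fun T => neg_mem (hw T), h.isChain_succ_iff.2 ⟨?_, ?_⟩⟩, ?_⟩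
  · rwa [h.lowPart_join]
  · rw [h.highPart_join]
    intro T hT
    simp [hwc T hT]
  · refine h.parts_ext ?_ ?_
    · rw [h.lowPart_koszulDiff hact, h.lowPart_join, h.highPart_join, hud]
      ext T
      simp
    · rw [h.highPart_koszulDiff hact, h.highPart_join, map_neg, neg_neg, hwd]

end IsLeastExtension

end MappingCone

/-! ### Homogeneous components on the coordinate ring -/

section Homogeneous

variable {k σ : Type*} [Field k]

theorem eval_smul_of_isHomogeneous [Fintype σ] {f : MvPolynomial σ k} {m : ℕ} (hf : f.IsHomogeneous m)
    (a : k) (v : σ → k) : eval (a • v) f = a ^ m * eval v f := by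
  rw [eval_eq', eval_eq', Finset.mul_sum]
  refine Finset.sum_congr rfl fun d hd => ?_
  have hm : m = ∑ i, d i := by
    rw [hf.degree_eq_sum_deg_support hd]
    exact Finsupp.degree_eq_sum d
  simp only [Pi.smul_apply, smul_eq_mul, mul_pow, Finset.prod_mul_distrib]
  rw [Finset.prod_pow_eq_pow_sum, ← hm]
  ring

theorem eq_zero_of_sum_pow_mul_eq_zero [Infinite k] {n : ℕ} {a : ℕ → k}
    (h : ∀ c : k, c ≠ 0 → ∑ m ∈ Finset.range n, c ^ m * a m = 0) {m : ℕ} (hm : m < n) : a m = 0 := by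
  set p : Polynomial k := ∑ m ∈ Finset.range n, Polynomial.C (a m) * Polynomial.X ^ m with hp
  have hp0 : p = 0 := by
    refine Polynomial.eq_zero_of_infinite_isRoot p (Set.Infinite.mono ?_
      (Set.finite_singleton (0 : k)).infinite_compl)
    intro c hc
    have := h c hc
    simp only [Set.mem_ofPred_eq, Polynomial.IsRoot.def, hp, Polynomial.eval_finsetSum,
      Polynomial.eval_mul, Polynomial.eval_C, Polynomial.eval_pow, Polynomial.eval_X]
    rw [← this]
    exact Finset.sum_congr rfl fun _ _ => mul_comm _ _
  have := congrArg (Polynomial.coeff · m) hp0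
  simpa [hp, Polynomial.finsetSum_coeff, Polynomial.coeff_C_mul, Polynomial.coeff_X_pow, hm] using this

theorem smul_mem_cone {Y : Set (ℙ k (σ → k))} {v : σ → k} (hv : v ∈ cone Y) {a : k} (ha : a ≠ 0) :
    a • v ∈ cone Y := by
  obtain ⟨hv0, h⟩ := hv
  refine ⟨smul_ne_zero ha hv0, ?_⟩
  convert h using 1
  rw [Projectivization.mk_eq_mk_iff']
  exact ⟨a, rfl⟩

variable [Fintype σ]

theorem eval_smul_eq_sum (f : MvPolynomial σ k) (a : k) (v : σ → k) : eval (a • v) f =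
    ∑ m ∈ Finset.range (f.totalDegree + 1), a ^ m * eval v (homogeneousComponent m f) := by
  conv_lhs => rw [← sum_homogeneousComponent f]
  rw [map_sum]
  exact Finset.sum_congr rfl fun m _ =>
    eval_smul_of_isHomogeneous (homogeneousComponent_isHomogeneous m f) a v

/-- The cone is stable under scaling, so along each line `f` becomes a polynomial in the scalar with
infinitely many roots; its coefficients are the values of the components. -/
theorem homogeneousComponent_mem_vanishingIdeal [Infinite k] {Y : Set (ℙ k (σ → k))}
    {f : MvPolynomial σ k} (hf : f ∈ vanishingIdeal Y) (m : ℕ) :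
    homogeneousComponent m f ∈ vanishingIdeal Y := by
  intro v hv
  by_cases hm : m < f.totalDegree + 1
  · refine eq_zero_of_sum_pow_mul_eq_zero (a := fun m => eval v (homogeneousComponent m f))
      (fun c hc => ?_) hm
    rw [← eval_smul_eq_sum]
    exact hf _ (smul_mem_cone hv hc)
  · rw [homogeneousComponent_eq_zero _ _ (by omega), map_zero]

theorem eval_eq_zero_iff_of_smul {f : MvPolynomial σ k} {m : ℕ} (hf : f.IsHomogeneous m) {a : k}
    (ha : a ≠ 0) (v : σ → k) : eval (a • v) f = 0 ↔ eval v f = 0 := by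
  rw [eval_smul_of_isHomogeneous hf, mul_eq_zero_iff_left (pow_ne_zero _ ha)]

theorem eval_rep_eq_zero_iff {f : MvPolynomial σ k} {m : ℕ} (hf : f.IsHomogeneous m) (v : σ → k)
    (hv : v ≠ 0) : eval (Projectivization.mk k v hv).rep f = 0 ↔ eval v f = 0 := by
  obtain ⟨a, ha⟩ := Projectivization.exists_smul_eq_mk_rep k v hv
  rw [← ha]
  exact eval_eq_zero_iff_of_smul hf a.ne_zero v

/-- The forms defining `Y` belong to its ideal, so the ideal cuts out no more than the cone. -/
theorem mem_cone_of_forall_vanishingIdeal {Y : Set (ℙ k (σ → k))} (hY : IsAlgebraicSet Y) {v : σ → k}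
    (hv : v ≠ 0) (h : ∀ f ∈ vanishingIdeal Y, eval v f = 0) : v ∈ cone Y := by
  obtain ⟨F, hF, rfl⟩ := hY
  refine ⟨hv, fun f hf => ?_⟩
  obtain ⟨m, hm⟩ := hF f hf
  rw [eval_rep_eq_zero_iff hm]
  refine h f fun w hw => ?_
  exact (eval_rep_eq_zero_iff hm w hw.1).1 (hw.2 f hf)

theorem coordMap_surjective (Y : Set (ℙ k (σ → k))) : Function.Surjective (coordMap Y) :=
  Ideal.Quotient.mk_surjective

theorem coordMap_eq_zero_iff {Y : Set (ℙ k (σ → k))} {f : MvPolynomial σ k} :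
    coordMap Y f = 0 ↔ f ∈ vanishingIdeal Y :=
  Ideal.Quotient.eq_zero_iff_mem

theorem homogeneousComponent_mul_of_isHomogeneous {f g : MvPolynomial σ k} {d : ℕ}
    (hf : f.IsHomogeneous d) (m : ℕ) : homogeneousComponent m (f * g) =
      if d ≤ m then f * homogeneousComponent (m - d) g else 0 := by
  let _ := MvPolynomial.gradedAlgebra (σ := σ) (R := k)
  have h := DirectSum.coe_decompose_mul_of_left_mem (homogeneousSubmodule σ k) m (a := f) (b := g) hf
  have hd : ∀ (φ : MvPolynomial σ k) i,
      (DirectSum.decompose (homogeneousSubmodule σ k) φ i : MvPolynomial σ k) =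
        homogeneousComponent i φ := decomposition.decompose'_apply
  rwa [hd, hd] at h

/-! ### The grading of the coordinate ring -/

section CoordProj

variable {Y : Set (ℙ k (σ → k))}

theorem coordMap_mem_coordPiece {f : MvPolynomial σ k} {m : ℕ} (hf : f.IsHomogeneous m) :
    coordMap Y f ∈ coordPiece Y m :=
  Submodule.mem_map_of_mem hf

theorem mem_coordPiece_iff {a : CoordRing Y} {m : ℕ} :
    a ∈ coordPiece Y m ↔ ∃ f : MvPolynomial σ k, f.IsHomogeneous m ∧ coordMap Y f = a :=
  Iff.rfl

theorem mul_mem_coordPiece {a b : CoordRing Y} {d m : ℕ} (ha : a ∈ coordPiece Y d)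
    (hb : b ∈ coordPiece Y m) : a * b ∈ coordPiece Y (d + m) := by
  obtain ⟨f, hf, rfl⟩ := mem_coordPiece_iff.1 ha
  obtain ⟨g, hg, rfl⟩ := mem_coordPiece_iff.1 hb
  exact ⟨f * g, hf.mul hg, map_mul (coordMap Y) f g⟩

theorem finite_homogeneousSubmodule (m : ℕ) : Module.Finite k (homogeneousSubmodule σ k m) :=
  Module.Finite.iff_fg.2 (homogeneousSubmodule_fg _ _ m)

instance (m : ℕ) : Module.Finite k (coordPiece Y m) :=
  have := finite_homogeneousSubmodule (k := k) (σ := σ) m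
  Module.Finite.map _ _

theorem nontrivial_coordRing {n : ℕ} (h : HasDim Y n) : Nontrivial (CoordRing Y) := by
  by_contra hn
  rw [not_nontrivial_iff_subsingleton] at hn
  have h' : ringKrullDim (CoordRing Y) = ((n + 1 : ℕ) : WithBot ℕ∞) := h
  rw [ringKrullDim_eq_bot_of_subsingleton] at h'
  exact absurd h' (WithBot.bot_ne_coe)

variable [Infinite k] (Y)

/-- The projection of the coordinate ring to its homogeneous piece of degree `m`. -/
def coordProj (m : ℕ) : CoordRing Y →ₗ[k] CoordRing Y :=
  ((LinearMap.ker (coordMap Y).toLinearMap).liftQ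
    ((coordMap Y).toLinearMap.comp (homogeneousComponent m)) fun _ hf =>
      coordMap_eq_zero_iff.2
        (homogeneousComponent_mem_vanishingIdeal (coordMap_eq_zero_iff.1 hf) m)).comp
  ((coordMap Y).toLinearMap.quotKerEquivOfSurjective (coordMap_surjective Y)).symm.toLinearMap

theorem coordProj_coordMap (m : ℕ) (f : MvPolynomial σ k) :
    coordProj Y m (coordMap Y f) = coordMap Y (homogeneousComponent m f) := by
  have h : ((coordMap Y).toLinearMap.quotKerEquivOfSurjective (coordMap_surjective Y)).symm
      (coordMap Y f) = Submodule.Quotient.mk f := by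
    rw [LinearEquiv.symm_apply_eq]
    rfl
  rw [coordProj, LinearMap.comp_apply, LinearEquiv.coe_coe, h]
  rfl

variable {Y}

theorem coordProj_mem (m : ℕ) (a : CoordRing Y) : coordProj Y m a ∈ coordPiece Y m := by
  obtain ⟨f, rfl⟩ := coordMap_surjective Y a
  rw [coordProj_coordMap]
  exact coordMap_mem_coordPiece (homogeneousComponent_isHomogeneous m f)

theorem coordProj_of_mem {m m' : ℕ} {a : CoordRing Y} (ha : a ∈ coordPiece Y m) :
    coordProj Y m' a = if m = m' then a else 0 := by
  obtain ⟨f, hf, rfl⟩ := mem_coordPiece_iff.1 ha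
  rw [coordProj_coordMap, homogeneousComponent_of_mem (m := m') hf]
  simp only [eq_comm (a := m)]
  split_ifs <;> simp

theorem coordProj_mul {f : MvPolynomial σ k} {d : ℕ} (hf : f.IsHomogeneous d) (m : ℕ)
    (a : CoordRing Y) : coordProj Y m (coordMap Y f * a) =
      if d ≤ m then coordMap Y f * coordProj Y (m - d) a else 0 := by
  obtain ⟨g, rfl⟩ := coordMap_surjective Y a
  rw [← map_mul, coordProj_coordMap, homogeneousComponent_mul_of_isHomogeneous hf]
  split_ifs
  · rw [map_mul, coordProj_coordMap]
  · simp

theorem eq_sum_coordProj (a : CoordRing Y) :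
    ∃ n, a = ∑ m ∈ Finset.range n, coordProj Y m a := by
  obtain ⟨f, rfl⟩ := coordMap_surjective Y a
  refine ⟨f.totalDegree + 1, ?_⟩
  simp only [coordProj_coordMap]
  rw [← map_sum, sum_homogeneousComponent]

end CoordProj

end Homogeneous

/-! ### Graded boundaries from ungraded ones -/

section GradedProjection

variable {k σ M : Type*} [Field k] [Fintype σ] [LinearOrder σ] [AddCommGroup M] [Module k M]
  [Module (MvPolynomial σ k) M] [IsScalarTower k (MvPolynomial σ k) M]

variable (k σ) in
/-- The maps `π j` are the projections of a graded module to its homogeneous pieces `𝓜 j`. -/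
structure IsGradedProjection (𝓜 : ℕ → Submodule k M) (π : ℕ → M →ₗ[k] M) : Prop where
  mem : ∀ j m, π j m ∈ 𝓜 j
  eq_self : ∀ j, ∀ m ∈ 𝓜 j, π j m = m
  zero : ∀ (i : σ) m, π 0 ((X i : MvPolynomial σ k) • m) = 0
  succ : ∀ (i : σ) j m, π (j + 1) ((X i : MvPolynomial σ k) • m) =
    (X i : MvPolynomial σ k) • π j m

variable {𝓜 : ℕ → Submodule k M} {π : ℕ → M →ₗ[k] M} (h : IsGradedProjection k σ 𝓜 π)
include h

/-- Projecting the coefficients of an ungraded preimage to degree `j - 1` leaves its boundary in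
degree `j` unchanged. For `j = 0` the projection kills every multiple of a variable, which forces `z
= 0`. -/
theorem IsGradedProjection.mem_koszulBoundaries {p j : ℕ} {z w : Finset σ → M}
    (hz : z ∈ koszulChains k σ 𝓜 p j) (hw : koszulDiff k σ w = z) :
    z ∈ koszulBoundaries k σ 𝓜 p j := by
  rw [mem_koszulChains] at hz
  have hz' : (fun T => π j (z T)) = z := funext fun T => h.eq_self j _ (hz.1 T)
  have hw0 : koszulDiff k σ (chainPart (p + 1) w) = z := by
    rw [koszulDiff_eq_familyDiff (x := X) (fun _ _ => rfl)] at hw ⊢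
    rw [familyDiff_chainPart, hw, hz.2.chainPart_eq]
  cases j with
  | zero =>
    rw [mem_koszulBoundaries_zero, ← hz', ← hw0]
    ext T
    rw [koszulDiff_apply, map_sum]
    exact Finset.sum_eq_zero fun i _ => by rw [map_smul, h.zero, smul_zero]
  | succ j =>
    rw [mem_koszulBoundaries_succ]
    refine ⟨fun T => π j (chainPart (p + 1) w T), ⟨fun T => h.mem _ _, fun T hT => ?_⟩, ?_⟩
    · dsimp only
      rw [isChain_chainPart _ _ T hT, map_zero]
    · rw [← hz', ← hw0]
      ext T
      rw [koszulDiff_apply, koszulDiff_apply, map_sum]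
      exact Finset.sum_congr rfl fun i _ => by rw [map_smul, h.succ]

theorem IsGradedProjection.torVanishes {p : ℕ}
    (hp : KoszulExact M (X : σ → MvPolynomial σ k) p) (j : ℕ) : TorVanishes k σ 𝓜 p j := by
  intro z hz
  obtain ⟨w, -, hw⟩ := hp z (mem_koszulCycles.1 hz).1.2 (by
    rw [← koszulDiff_eq_familyDiff (k := k) fun _ _ => rfl]
    exact (mem_koszulCycles.1 hz).2)
  refine h.mem_koszulBoundaries hz.1 (w := w) ?_
  rw [← hw, koszulDiff_eq_familyDiff fun _ _ => rfl]

end GradedProjection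

/-! ### `Tor₀` as the space of generators -/

section TorZero

variable {k σ M : Type*} [Field k] [Fintype σ] [LinearOrder σ] [AddCommGroup M] [Module k M]
  [Module (MvPolynomial σ k) M] [IsScalarTower k (MvPolynomial σ k) M]

/-- The elements of degree `j` that are combinations of elements of degree `j - 1`. -/
def decomposables (k σ : Type*) [Field k] [Fintype σ] {M : Type*} [AddCommGroup M] [Module k M]
    [Module (MvPolynomial σ k) M] [IsScalarTower k (MvPolynomial σ k) M]
    (𝓜 : ℕ → Submodule k M) : ℕ → Submodule k M
  | 0 => ⊥
  | j + 1 => LinearMap.range (∑ i : σ, ((Algebra.lsmul k k M (X i : MvPolynomial σ k)).comp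
      ((𝓜 j).subtype.comp (LinearMap.proj i)) : (σ → 𝓜 j) →ₗ[k] M))

variable {𝓜 : ℕ → Submodule k M}

theorem mem_decomposables_succ {j : ℕ} {m : M} : m ∈ decomposables k σ 𝓜 (j + 1) ↔
    ∃ g : σ → M, (∀ i, g i ∈ 𝓜 j) ∧ ∑ i, (X i : MvPolynomial σ k) • g i = m := by
  simp only [decomposables, LinearMap.mem_range, LinearMap.sum_apply, LinearMap.comp_apply,
    LinearMap.proj_apply, Submodule.subtype_apply, Algebra.lsmul_coe]
  constructor
  · rintro ⟨y, rfl⟩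
    exact ⟨fun i => y i, fun i => (y i).2, rfl⟩
  · rintro ⟨g, hg, rfl⟩
    exact ⟨fun i => ⟨g i, hg i⟩, rfl⟩

theorem decomposables_le (hmul : ∀ (i : σ) j, ∀ m ∈ 𝓜 j, (X i : MvPolynomial σ k) • m ∈ 𝓜 (j + 1))
    (j : ℕ) : decomposables k σ 𝓜 j ≤ 𝓜 j := by
  cases j with
  | zero => exact bot_le
  | succ j =>
    intro m hm
    obtain ⟨g, hg, rfl⟩ := mem_decomposables_succ.1 hm
    exact sum_mem fun i _ => hmul i j _ (hg i)

/-- Chains of homological degree zero are elements of the module. -/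
def koszulCyclesZeroEquiv (𝓜 : ℕ → Submodule k M) (j : ℕ) : koszulCycles k σ 𝓜 0 j ≃ₗ[k] 𝓜 j where
  toFun c := ⟨c.1 ∅, (mem_koszulCycles.1 c.2).1.1 ∅⟩
  map_add' _ _ := rfl
  map_smul' _ _ := rfl
  invFun m := ⟨fun T => if T.card = 0 then m.1 else 0, mem_koszulCycles.2 ⟨⟨fun T => by
      split_ifs
      exacts [m.2, zero_mem _], fun T hT => if_neg hT⟩, by
      ext T
      rw [koszulDiff_apply]
      refine Finset.sum_eq_zero fun i _ => ?_
      rw [if_neg (by simp), smul_zero, smul_zero]⟩⟩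
  left_inv c := by
    ext T
    by_cases hT : T.card = 0
    · obtain rfl := Finset.card_eq_zero.1 hT
      simp
    · simp [hT, (mem_koszulCycles.1 c.2).1.2 T hT]
  right_inv m := by simp

theorem mem_koszulBoundaries_iff_of_cycle {j : ℕ} (c : koszulCycles k σ 𝓜 0 j) :
    c.1 ∈ koszulBoundaries k σ 𝓜 0 j ↔ c.1 ∅ ∈ decomposables k σ 𝓜 j := by
  have hc : c.1 = 0 ↔ c.1 ∅ = 0 := by
    refine ⟨fun h => by rw [h]; rfl, fun h => funext fun T => ?_⟩
    by_cases hT : T.card = 0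
    · rw [Finset.card_eq_zero.1 hT, h]
      rfl
    · exact (mem_koszulCycles.1 c.2).1.2 T hT
  cases j with
  | zero =>
    rw [mem_koszulBoundaries_zero, hc]
    exact (Submodule.mem_bot k).symm
  | succ j =>
    rw [mem_koszulBoundaries_succ, mem_decomposables_succ]
    have hd : ∀ w : Finset σ → M, koszulDiff k σ w = familyDiff (X : σ → MvPolynomial σ k) w :=
      koszulDiff_eq_familyDiff fun _ _ => rfl
    constructor
    · rintro ⟨w, ⟨hw, hwc⟩, h⟩
      exact ⟨fun i => w {i}, fun i => hw _, by rw [← familyDiff_empty, ← hd, h]⟩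
    · rintro ⟨g, hg, h⟩
      refine ⟨singleChain g, ⟨fun T => sum_mem fun i _ => ?_, isChain_singleChain g⟩, ?_⟩
      · split_ifs
        exacts [hg i, zero_mem _]
      · ext T
        rw [hd]
        by_cases hT : T.card = 0
        · rw [Finset.card_eq_zero.1 hT, familyDiff_empty, ← h]
          exact Finset.sum_congr rfl fun i _ => by rw [singleChain_singleton]
        · rw [(mem_koszulCycles.1 c.2).1.2 T hT,
            familyDiff_apply_eq_zero X (isChain_singleChain g) hT]

theorem gradedBetti_zero_eq (j : ℕ) : gradedBetti k σ 𝓜 0 j =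
    Module.finrank k (𝓜 j ⧸ (decomposables k σ 𝓜 j).submoduleOf (𝓜 j)) := by
  refine LinearEquiv.finrank_eq (Submodule.Quotient.equiv _ _ (koszulCyclesZeroEquiv 𝓜 j) ?_)
  ext m
  rw [Submodule.mem_map_equiv]
  refine (mem_koszulBoundaries_iff_of_cycle _).trans ?_
  conv_rhs => rw [← (koszulCyclesZeroEquiv (σ := σ) 𝓜 j).apply_symm_apply m]
  rfl

theorem torVanishes_zero_iff [∀ j, Module.Finite k (𝓜 j)] {j : ℕ} :
    TorVanishes k σ 𝓜 0 j ↔ 𝓜 j ≤ decomposables k σ 𝓜 j := by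
  rw [← gradedBetti_eq_zero_iff, gradedBetti_zero_eq, Module.finrank_zero_iff,
    Submodule.Quotient.subsingleton_iff, Submodule.submoduleOf_eq_top]

end TorZero

/-! ### The coordinate ring over the subrings `S_t` -/

section Tail

variable {k : Type*} [Field k] {N : ℕ} {Y : Set (ℙ k (Fin N → k))}

theorem coordRing_smul (f : MvPolynomial (Fin N) k) (a : CoordRing Y) : f • a = coordMap Y f * a :=
  rfl

theorem tail_smul {t : ℕ} (s : TailRing k N t) (a : CoordRing Y) :
    s • a = coordMap Y (rename Subtype.val s) * a :=
  rfl

theorem tail_X_smul {t : ℕ} (v : TailVar N t) (a : CoordRing Y) :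
    (X v : TailRing k N t) • a = coordMap Y (X v.1) * a := by
  rw [tail_smul, rename_X]

theorem coordMap_X_mul_mem (i : Fin N) (j : ℕ) (m : CoordRing Y) (hm : m ∈ coordPiece Y j) :
    coordMap Y (X i) * m ∈ coordPiece Y (j + 1) := by
  obtain ⟨f, hf, rfl⟩ := mem_coordPiece_iff.1 hm
  rw [← map_mul, add_comm]
  exact coordMap_mem_coordPiece ((isHomogeneous_X k i).mul hf)

theorem tail_X_smul_mem {t : ℕ} (v : TailVar N t) (j : ℕ) (m : CoordRing Y)
    (hm : m ∈ coordPiece Y j) : (X v : TailRing k N t) • m ∈ coordPiece Y (j + 1) := by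
  rw [tail_X_smul]
  exact coordMap_X_mul_mem _ _ _ hm

theorem isGradedProjection_coordProj_tail [Infinite k] (Y : Set (ℙ k (Fin N → k))) (t : ℕ) :
    IsGradedProjection k (TailVar N t) (coordPiece Y) (coordProj Y) where
  mem := coordProj_mem
  eq_self _ _ hm := by rw [coordProj_of_mem hm, if_pos rfl]
  zero i m := by rw [tail_X_smul, coordProj_mul (isHomogeneous_X k _), if_neg (by simp)]
  succ i j m := by
    rw [tail_X_smul, coordProj_mul (isHomogeneous_X k _), if_pos (by simp), tail_X_smul,
      Nat.add_sub_cancel]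

/-- The inclusion of the variables of `S_{t+1}` in those of `S_t`. -/
def tailSucc (N t : ℕ) : TailVar N (t + 1) ↪o TailVar N t :=
  Subtype.orderEmbedding fun _ h => (Nat.le_succ t).trans h

theorem isLeastExtension_tailSucc {t : ℕ} (ht : t < N) :
    IsLeastExtension (tailSucc N t) ⟨⟨t, ht⟩, le_refl t⟩ where
  lt a := Subtype.mk_lt_mk.2 (Fin.mk_lt_of_lt_val (Nat.lt_of_succ_le a.2))
  cover b := by
    rcases (show t ≤ b.1 from b.2).eq_or_lt with h | h
    · left
      exact Subtype.ext (Fin.ext h.symm)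
    · right
      exact ⟨⟨b.1, h⟩, rfl⟩

/-- `R` is indexed by `Fin N` and not by `TailVar N 0`, so the first dropped variable needs its own
step. -/
theorem isLeastExtension_tailOne (hN : 0 < N) :
    IsLeastExtension (OrderEmbedding.subtype _ : TailVar N 1 ↪o Fin N) ⟨0, hN⟩ where
  lt a := Fin.mk_lt_of_lt_val (Nat.lt_of_succ_le a.2)
  cover b := by
    rcases Nat.eq_zero_or_pos b.1 with h | h
    · left
      exact Fin.ext h
    · right
      exact ⟨⟨b, h⟩, rfl⟩

theorem tailSucc_act {t : ℕ} (a : TailVar N (t + 1)) (m : CoordRing Y) :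
    (X (tailSucc N t a) : TailRing k N t) • m = (X a : TailRing k N (t + 1)) • m := by
  rw [tail_X_smul, tail_X_smul]
  rfl

theorem tailOne_act (a : TailVar N 1) (m : CoordRing Y) :
    (X ((OrderEmbedding.subtype _ : TailVar N 1 ↪o Fin N) a) : MvPolynomial (Fin N) k) • m =
      (X a : TailRing k N 1) • m := by
  rw [tail_X_smul, coordRing_smul]
  rfl

/-- The ideal of the coordinate ring generated by the variables of `S_t`. -/
def tailIdeal (Y : Set (ℙ k (Fin N → k))) (t : ℕ) : Ideal (CoordRing Y) :=
  Ideal.span (Set.range fun v : TailVar N t => coordMap Y (X v.1))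

theorem tailIdeal_anti {t t' : ℕ} (h : t ≤ t') : tailIdeal Y t' ≤ tailIdeal Y t := by
  refine Ideal.span_mono ?_
  rintro _ ⟨v, rfl⟩
  exact ⟨⟨v.1, h.trans v.2⟩, rfl⟩

/-- If `Y` does not meet the centre of the projection then the coordinate ring is finite modulo the
variables of `S_t`. -/
theorem coordMap_X_mem_radical [IsAlgClosed k] (hY : IsAlgebraicSet Y) {t : ℕ}
    (hd : Disjoint Y (coordSubspace k N t)) (i : Fin N) :
    coordMap Y (X i) ∈ (tailIdeal Y t).radical := by
  set I : Ideal (MvPolynomial (Fin N) k) :=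
    ProjSyz.vanishingIdeal Y ⊔ Ideal.span (Set.range fun v : TailVar N t => X v.1) with hI
  have hX : (X i : MvPolynomial (Fin N) k) ∈ I.radical := by
    rw [← vanishingIdeal_zeroLocus_eq_radical (K := k) I]
    intro v hv
    rw [mem_zeroLocus_iff] at hv
    -- By the Nullstellensatz it is enough that the ideal has no zero but the origin: a nonzero zero
    -- would represent a point of `Y` on the centre of the projection.
    suffices h : v = 0 by simp [h]
    by_contra hv0
    have hc : v ∈ cone Y := mem_cone_of_forall_vanishingIdeal hY hv0 fun f hf => by
      have := hv f (Ideal.mem_sup_left hf)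
      rwa [← coe_aeval_eq_eval]
    refine Set.disjoint_left.1 hd hc.2 fun w => ?_
    have hw := hv (X w.1) (Ideal.mem_sup_right (Ideal.subset_span ⟨w, rfl⟩))
    rw [← eval_X (f := (Projectivization.mk k v hv0).rep), eval_rep_eq_zero_iff (isHomogeneous_X k _)]
    simpa using hw
  obtain ⟨q, hq⟩ := hX
  refine ⟨q, ?_⟩
  rw [← map_pow]
  have := Ideal.mem_map_of_mem (coordMap Y) hq
  rw [hI, Ideal.map_sup, Ideal.map_span] at this
  have h0 : Ideal.map (coordMap Y) (ProjSyz.vanishingIdeal Y) = ⊥ := by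
    rw [Ideal.map_eq_bot_iff_le_ker]
    exact fun f hf => coordMap_eq_zero_iff.2 hf
  rw [h0, bot_sup_eq] at this
  rwa [tailIdeal, show (Set.range fun v : TailVar N t => coordMap Y (X v.1)) =
    coordMap Y '' (Set.range fun v : TailVar N t => X v.1) by rw [← Set.range_comp]; rfl]

theorem gradedBetti_tailSucc_le {t p j : ℕ} (ht : t < N)
    (hv : TorVanishes k (TailVar N (t + 1)) (coordPiece Y) p (j + 1)) :
    gradedBetti k (TailVar N (t + 1)) (coordPiece Y) p j ≤
      gradedBetti k (TailVar N t) (coordPiece Y) (p + 1) j :=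
  (isLeastExtension_tailSucc ht).gradedBetti_le tailSucc_act hv
    fun _ hm => tail_X_smul_mem _ _ _ hm

theorem gradedBetti_tailOne_le {p j : ℕ} (hN : 0 < N)
    (hv : TorVanishes k (TailVar N 1) (coordPiece Y) p (j + 1)) :
    gradedBetti k (TailVar N 1) (coordPiece Y) p j ≤
      gradedBetti k (Fin N) (coordPiece Y) (p + 1) j :=
  (isLeastExtension_tailOne hN).gradedBetti_le tailOne_act hv
    fun _ hm => coordMap_X_mul_mem _ _ _ hm

variable [Infinite k]

/-- A power of `X i` lies in `tailIdeal Y t`, which annihilates the Koszul homology of its own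
generators; `X i` need not belong to `S_t`. -/
theorem exists_pow_mul_mem_koszulBoundaries {t p j : ℕ} {i : Fin N}
    (hi : coordMap Y (X i) ∈ (tailIdeal Y t).radical) {z : Finset (TailVar N t) → CoordRing Y}
    (hz : z ∈ koszulCycles k (TailVar N t) (coordPiece Y) p j) :
    ∃ q, (fun T => coordMap Y (X i ^ q) * z T) ∈
      koszulBoundaries k (TailVar N t) (coordPiece Y) p (j + q) := by
  obtain ⟨q, hq⟩ := hi
  have hd := koszulDiff_eq_familyDiff (k := k) (N := CoordRing Y)
    (x := fun v : TailVar N t => coordMap Y (X v.1)) tail_X_smul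
  rw [mem_koszulCycles] at hz
  obtain ⟨w, hw⟩ := exists_familyDiff_eq_smul (fun v : TailVar N t => coordMap Y (X v.1))
    (z := z) (by rw [← hd]; exact hz.2) hq
  refine ⟨q, (isGradedProjection_coordProj_tail Y t).mem_koszulBoundaries (w := w)
    (mem_koszulChains.2 ⟨fun T => ?_, fun T hT => ?_⟩) ?_⟩
  · rw [add_comm]
    have h := (isHomogeneous_X k i).pow q
    rw [one_mul] at h
    exact mul_mem_coordPiece (coordMap_mem_coordPiece h) (hz.1.1 T)
  · simp [hz.1.2 T hT]
  · rw [hd, hw, map_pow]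
    rfl

theorem torVanishes_tailSucc {t p d : ℕ} (ht : t < N)
    (hi : ∀ i, coordMap Y (X i) ∈ (tailIdeal Y (t + 1)).radical)
    (hv : ∀ j ≥ d, TorVanishes k (TailVar N t) (coordPiece Y) (p + 1) j) :
    ∀ j ≥ d, TorVanishes k (TailVar N (t + 1)) (coordPiece Y) p j := by
  refine (isLeastExtension_tailSucc ht).torVanishes_of_succ tailSucc_act hv
    (fun j m hm => tail_X_smul_mem _ _ _ hm) fun j z hz => ?_
  obtain ⟨q, hq⟩ := exists_pow_mul_mem_koszulBoundaries (hi ⟨t, ht⟩) hz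
  refine ⟨q, ?_⟩
  simpa only [tail_smul, map_pow, rename_X] using hq

theorem torVanishes_tailOne {p d : ℕ} (hN : 0 < N)
    (hi : ∀ i, coordMap Y (X i) ∈ (tailIdeal Y 1).radical)
    (hv : ∀ j ≥ d, TorVanishes k (Fin N) (coordPiece Y) (p + 1) j) :
    ∀ j ≥ d, TorVanishes k (TailVar N 1) (coordPiece Y) p j := by
  refine (isLeastExtension_tailOne hN).torVanishes_of_succ tailOne_act hv
    (fun j m hm => coordMap_X_mul_mem _ _ _ hm) fun j z hz => ?_
  obtain ⟨q, hq⟩ := exists_pow_mul_mem_koszulBoundaries (hi ⟨0, hN⟩) hz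
  exact ⟨q, hq⟩

/-- Each dropped variable lowers the homological range by one. The nilpotency needed for `t ≤ α`
follows from that for `α`, as `tailIdeal` only grows when `t` decreases. -/
theorem torVanishes_tail {α d : ℕ} (hα : α < N)
    (hi : ∀ i, coordMap Y (X i) ∈ (tailIdeal Y α).radical)
    (hv : ∀ p ≤ α, ∀ j ≥ d, TorVanishes k (Fin N) (coordPiece Y) p j) :
    ∀ t, 1 ≤ t → ∀ p, p + t ≤ α → ∀ j ≥ d, TorVanishes k (TailVar N t) (coordPiece Y) p j := by
  have hi' : ∀ t ≤ α, ∀ i, coordMap Y (X i) ∈ (tailIdeal Y t).radical := fun t ht i =>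
    Ideal.radical_mono (tailIdeal_anti ht) (hi i)
  intro t ht
  induction t, ht using Nat.le_induction with
  | base =>
    intro p hp
    exact torVanishes_tailOne (by omega) (hi' 1 (by omega)) (hv (p + 1) hp)
  | succ t _ ih =>
    intro p hp
    exact torVanishes_tailSucc (by omega) (hi' (t + 1) (by omega)) (ih (p + 1) (by omega))

/-- Covers `α = 0`: the rings agree but their index types differ, so decomposable elements are
compared instead of Koszul complexes. -/
theorem torVanishes_tailZero_zero {j : ℕ} (hv : TorVanishes k (Fin N) (coordPiece Y) 0 j) :
    TorVanishes k (TailVar N 0) (coordPiece Y) 0 j := by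
  rw [torVanishes_zero_iff] at hv ⊢
  refine hv.trans ?_
  cases j with
  | zero => exact le_rfl
  | succ j =>
    intro m hm
    obtain ⟨g, hg, rfl⟩ := mem_decomposables_succ.1 hm
    refine mem_decomposables_succ.2 ⟨fun v => g v.1, fun v => hg _, ?_⟩
    refine Fintype.sum_equiv (Equiv.subtypeUnivEquiv fun i : Fin N => Nat.zero_le _) _ _ fun v => ?_
    rw [tail_X_smul]
    rfl

theorem torVanishes_tail_zero {α d : ℕ} (hα : α < N)
    (hi : ∀ i, coordMap Y (X i) ∈ (tailIdeal Y α).radical)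
    (hv : ∀ p ≤ α, ∀ j ≥ d, TorVanishes k (Fin N) (coordPiece Y) p j) :
    ∀ j ≥ d, TorVanishes k (TailVar N α) (coordPiece Y) 0 j := by
  intro j hj
  rcases Nat.eq_zero_or_pos α with rfl | h
  · exact torVanishes_tailZero_zero (hv 0 le_rfl j hj)
  · exact torVanishes_tail hα hi hv α h 0 (by omega) j hj

end Tail

/-! ### Numbers of generators over `S_t` -/

section Counting

variable {k : Type*} [Field k] {N : ℕ} {Y : Set (ℙ k (Fin N → k))}

theorem coordPiece_zero : coordPiece Y 0 = Submodule.span k {(1 : CoordRing Y)} := by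
  rw [coordPiece, homogeneousSubmodule_zero, Submodule.one_eq_span, Submodule.map_span]
  congr 1
  simp

theorem gradedBetti_tail_zero_zero [Nontrivial (CoordRing Y)] (t : ℕ) :
    gradedBetti k (TailVar N t) (coordPiece Y) 0 0 = 1 := by
  rw [gradedBetti_zero_eq, show (decomposables k (TailVar N t) (coordPiece Y) 0) = ⊥ from rfl,
    Submodule.submoduleOf, Submodule.comap_bot, Submodule.ker_subtype]
  rw [(Submodule.quotEquivOfEqBot _ rfl).finrank_eq, coordPiece_zero, finrank_span_singleton one_ne_zero]

theorem coordPiece_one :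
    coordPiece Y 1 = Submodule.span k (Set.range fun i => coordMap Y (X i)) := by
  rw [coordPiece, homogeneousSubmodule_one_eq_span_X, Submodule.map_span, ← Set.range_comp]
  rfl

theorem linearIndependent_coordMap_X (hY : IsNondegenerate Y) :
    LinearIndependent k fun i => coordMap Y (X i) := by
  rw [Fintype.linearIndependent_iff]
  intro g hg
  have h : (∑ i, g i • X i : MvPolynomial (Fin N) k) = 0 := by
    refine hY _ ((homogeneousSubmodule (Fin N) k 1).sum_mem fun i _ =>
      Submodule.smul_mem _ _ (isHomogeneous_X k i)) (coordMap_eq_zero_iff.1 ?_)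
    rw [map_sum, ← hg]
    exact Finset.sum_congr rfl fun i _ => map_smul _ _ _
  exact Fintype.linearIndependent_iff.1 (linearIndependent_X (Fin N) k) g h

theorem card_tailVar {t : ℕ} (ht : t ≤ N) : Fintype.card (TailVar N t) + t = N := by
  have h := Fintype.card_subtype_compl fun i : Fin N => t ≤ (i : ℕ)
  have h2 : Fintype.card {i : Fin N // ¬ t ≤ (i : ℕ)} = t := by
    have e : {i : Fin N // ¬ t ≤ (i : ℕ)} ≃ Fin t :=
      { toFun := fun i => ⟨i.1, by omega⟩
        invFun := fun i => ⟨Fin.castLE ht i, by simp⟩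
        left_inv := fun i => rfl
        right_inv := fun i => rfl }
    rw [Fintype.card_congr e, Fintype.card_fin]
  have h3 := Fintype.card_subtype_le fun i : Fin N => t ≤ (i : ℕ)
  rw [Fintype.card_fin] at h h3
  simp only [TailVar]
  omega

theorem decomposables_one (t : ℕ) : decomposables k (TailVar N t) (coordPiece Y) 1 =
    Submodule.span k (Set.range fun v : TailVar N t => coordMap Y (X v.1)) := by
  refine le_antisymm ?_ ?_
  · intro m hm
    obtain ⟨g, hg, rfl⟩ := mem_decomposables_succ.1 hm
    refine sum_mem fun v _ => ?_
    have hv := hg v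
    rw [coordPiece_zero, Submodule.mem_span_singleton] at hv
    obtain ⟨c, hc⟩ := hv
    rw [← hc, tail_X_smul, mul_smul_comm, mul_one]
    exact Submodule.smul_mem _ _ (Submodule.subset_span ⟨v, rfl⟩)
  · rw [Submodule.span_le]
    rintro _ ⟨v, rfl⟩
    refine mem_decomposables_succ.2 ⟨fun w => if w = v then 1 else 0, fun w => ?_, ?_⟩
    · dsimp only
      split_ifs
      · rw [coordPiece_zero]
        exact Submodule.mem_span_singleton_self _
      · exact zero_mem _
    · simp [tail_X_smul]

theorem decomposables_tail_le (t j : ℕ) :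
    decomposables k (TailVar N t) (coordPiece Y) j ≤ coordPiece Y j :=
  decomposables_le (fun v j m hm => tail_X_smul_mem v j m hm) j

/-- By nondegeneracy the `N` linear forms stay independent in the coordinate ring, and `N - t` of
them are decomposable over `S_t`. -/
theorem gradedBetti_tail_zero_one (hY : IsNondegenerate Y) {t : ℕ} (ht : t ≤ N) :
    gradedBetti k (TailVar N t) (coordPiece Y) 0 1 = t := by
  have hli := linearIndependent_coordMap_X hY
  have h1 : Module.finrank k (coordPiece Y 1) = N := by
    rw [coordPiece_one, finrank_span_eq_card hli, Fintype.card_fin]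
  have h2 : Module.finrank k (decomposables k (TailVar N t) (coordPiece Y) 1) =
      Fintype.card (TailVar N t) := by
    rw [decomposables_one]
    exact finrank_span_eq_card (hli.comp _ Subtype.val_injective)
  have h3 := Submodule.finrank_quotient_add_finrank
    ((decomposables k (TailVar N t) (coordPiece Y) 1).submoduleOf (coordPiece Y 1))
  rw [(Submodule.submoduleOfEquivOfLe (decomposables_tail_le t 1)).finrank_eq, h1, h2] at h3
  rw [gradedBetti_zero_eq]
  have := card_tailVar ht
  omega

/-- A monomial either is divisible by a variable of `S_t`, hence decomposable, or involves only the
first `t` variables. -/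
theorem coordMap_monomial_mem (t j : ℕ) {d : Fin N →₀ ℕ} (hd : d.degree = j) :
    coordMap Y (monomial d 1) ∈ Submodule.span k (Set.range fun s : Sym {i : Fin N // ¬ t ≤ (i : ℕ)} j =>
      coordMap Y (s.1.map fun i => (X i.1 : MvPolynomial (Fin N) k)).prod) ⊔
      decomposables k (TailVar N t) (coordPiece Y) j := by
  by_cases h : ∀ i : Fin N, d i ≠ 0 → ¬ t ≤ (i : ℕ)
  · refine Submodule.mem_sup_left (Submodule.subset_span ?_)
    have hcard : d.toMultiset.card = j := by rw [Finsupp.card_toMultiset, ← hd]; rfl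
    have hmem : ∀ i ∈ d.toMultiset, ¬ t ≤ (i : ℕ) := fun i hi => h i (by
      rwa [Finsupp.mem_toMultiset, Finsupp.mem_support_iff] at hi)
    obtain ⟨s, hs⟩ : ∃ s : Multiset {i : Fin N // ¬ t ≤ (i : ℕ)}, s.map Subtype.val = d.toMultiset :=
      CanLift.prf (cond := fun s : Multiset (Fin N) => ∀ i ∈ s, ¬ t ≤ (i : ℕ)) _ hmem
    refine ⟨⟨s, by rw [← hcard, ← hs, Multiset.card_map]⟩, ?_⟩
    dsimp only
    congr 1
    have : s.map (fun i => (X i.1 : MvPolynomial (Fin N) k)) = d.toMultiset.map X := by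
      rw [← hs, Multiset.map_map]
      rfl
    rw [this, Finset.prod_multiset_map_count, Finsupp.toFinset_toMultiset, monomial_eq, C_1, one_mul]
    exact Finset.prod_congr rfl fun i _ => by rw [Finsupp.count_toMultiset]
  · push Not at h
    obtain ⟨i, hi, hit⟩ := h
    refine Submodule.mem_sup_right ?_
    have hdi : d = Finsupp.single i 1 + (d - Finsupp.single i 1) := by
      rw [add_tsub_cancel_of_le]
      rw [Finsupp.single_le_iff]
      omega
    have hdeg : j = 1 + (d - Finsupp.single i 1).degree := by
      rw [← hd]
      conv_lhs => rw [hdi, map_add, Finsupp.degree_single]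
    rw [hdeg, add_comm 1]
    refine mem_decomposables_succ.2
      ⟨fun w => if w = ⟨i, hit⟩ then coordMap Y (monomial (d - Finsupp.single i 1) 1) else 0,
        fun w => ?_, ?_⟩
    · dsimp only
      split_ifs
      · exact coordMap_mem_coordPiece (isHomogeneous_monomial _ rfl)
      · exact zero_mem _
    · simp only [smul_ite, smul_zero, Finset.sum_ite_eq', Finset.mem_univ, if_true]
      rw [tail_X_smul, ← map_mul, X, monomial_mul, one_mul, ← hdi]

/-- Monomials of degree `j` in the first `t` variables span the generators; they are counted as
multisets. For `t = 0` truncated subtraction still gives the right count, `1` for `j = 0` and `0`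
otherwise. -/
theorem gradedBetti_tail_zero_le {t : ℕ} (ht : t ≤ N) (j : ℕ) :
    gradedBetti k (TailVar N t) (coordPiece Y) 0 j ≤ (t + j - 1).choose j := by
  have hhom : ∀ s : Multiset {i : Fin N // ¬ t ≤ (i : ℕ)},
      (s.map fun i => (X i.1 : MvPolynomial (Fin N) k)).prod.IsHomogeneous s.card := fun s => by
    induction s using Multiset.induction with
    | empty => simpa using isHomogeneous_one (Fin N) k
    | cons a s ih =>
      simp only [Multiset.map_cons, Multiset.prod_cons, Multiset.card_cons]
      rw [add_comm]
      exact (isHomogeneous_X k _).mul ih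
  set G : Sym {i : Fin N // ¬ t ≤ (i : ℕ)} j → CoordRing Y := fun s =>
      coordMap Y (s.1.map fun i => (X i.1 : MvPolynomial (Fin N) k)).prod with hG
  have hGmem : ∀ s, G s ∈ coordPiece Y j := fun s => by
    have := hhom s.1
    rw [s.2] at this
    exact coordMap_mem_coordPiece this
  have hle : coordPiece Y j ≤ Submodule.span k (Set.range G) ⊔
      decomposables k (TailVar N t) (coordPiece Y) j := by
    rintro _ ⟨f, hf, rfl⟩
    have hf' : f.IsHomogeneous j := hf
    rw [f.as_sum, map_sum]
    refine sum_mem fun d hd => ?_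
    have : monomial d (coeff d f) = coeff d f • monomial d (1 : k) := by
      rw [smul_monomial, smul_eq_mul, mul_one]
    rw [this, map_smul]
    refine Submodule.smul_mem _ _ (coordMap_monomial_mem t j ?_)
    by_contra hne
    exact (mem_support_iff.1 hd) (hf'.coeff_eq_zero hne)
  have hcard : Fintype.card (Sym {i : Fin N // ¬ t ≤ (i : ℕ)} j) = (t + j - 1).choose j := by
    rw [Sym.card_sym_eq_choose]
    congr 2
    have h := Fintype.card_subtype_compl fun i : Fin N => t ≤ (i : ℕ)
    have := card_tailVar ht
    rw [Fintype.card_fin] at h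
    rw [h]
    simp only [TailVar] at this
    omega
  rw [gradedBetti_zero_eq, ← hcard]
  set D := (decomposables k (TailVar N t) (coordPiece Y) j).submoduleOf (coordPiece Y j)
  have hspan : Submodule.span k (Set.range fun s => D.mkQ ⟨G s, hGmem s⟩) = ⊤ := by
    rw [eq_top_iff]
    intro y _
    obtain ⟨⟨m, hm⟩, rfl⟩ := D.mkQ_surjective y
    obtain ⟨a, ha, b, hb, hab⟩ := Submodule.mem_sup.1 (hle hm)
    have hsp : Submodule.span k (Set.range G) ≤ coordPiece Y j := by
      rw [Submodule.span_le]
      rintro _ ⟨s, rfl⟩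
      exact hGmem s
    have hbm := decomposables_tail_le t j hb
    have heq : D.mkQ ⟨m, hm⟩ = D.mkQ ⟨a, hsp ha⟩ := by
      rw [Submodule.mkQ_apply, Submodule.mkQ_apply, Submodule.Quotient.eq]
      change m - a ∈ decomposables k (TailVar N t) (coordPiece Y) j
      rw [← hab, add_sub_cancel_left]
      exact hb
    rw [heq]
    have : ∀ (a : CoordRing Y) (ha : a ∈ Submodule.span k (Set.range G)), D.mkQ ⟨a, hsp ha⟩ ∈
        Submodule.span k (Set.range fun s => D.mkQ ⟨G s, hGmem s⟩) := by
      intro a ha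
      induction ha using Submodule.span_induction with
      | mem x hx =>
        obtain ⟨s, rfl⟩ := hx
        exact Submodule.subset_span ⟨s, rfl⟩
      | zero => exact (map_zero D.mkQ) ▸ zero_mem _
      | add x y hx hy ihx ihy => exact (map_add D.mkQ ⟨x, hsp hx⟩ ⟨y, hsp hy⟩) ▸ add_mem ihx ihy
      | smul c x hx ih => exact (map_smul D.mkQ c ⟨x, hsp hx⟩) ▸ Submodule.smul_mem _ _ ih
    exact this a ha
  rw [← finrank_top, ← hspan]
  exact finrank_range_le_card _

end Counting

/-! ### The variables form a regular sequence -/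

section Depth

/-- The initial segments generate monomial ideals, and a monomial divisible by one of their
variables remains so after cancelling a different variable. -/
theorem isWeaklyRegular_map_X {k σ : Type*} [Field k] {l : List σ} (hl : l.Nodup) :
    RingTheory.Sequence.IsWeaklyRegular (MvPolynomial σ k)
      (l.map (X : σ → MvPolynomial σ k)) where
  regular_mod_prev i h := by
    rw [isSMulRegular_quotient_iff_mem_of_smul_mem]
    intro f hf
    have hI : Ideal.ofList ((l.map (X : σ → MvPolynomial σ k)).take i) =
        Ideal.span (X '' {a | a ∈ l.take i}) := by
      rw [Ideal.ofList, ← List.map_take]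
      congr 1
      ext g
      exact List.mem_map
    rw [smul_eq_mul, Ideal.mul_top, hI, mem_ideal_span_X_image] at hf ⊢
    rw [List.length_map] at h
    intro m hm
    rw [List.getElem_map] at hf
    obtain ⟨a, ha, hma⟩ := hf (Finsupp.single l[i] 1 + m) (by
      rw [mem_support_iff, smul_eq_mul, coeff_X_mul]
      exact mem_support_iff.1 hm)
    refine ⟨a, ha, ?_⟩
    have hne : l[i] ≠ a := by
      rintro rfl
      have hnd := hl.sublist (List.take_sublist (i + 1) l)
      rw [List.take_succ_eq_append_getElem h, List.nodup_append] at hnd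
      exact hnd.2.2 _ ha _ (List.mem_singleton_self _) rfl
    simpa [Finsupp.single_apply, hne] using hma

theorem ofList_map_univ {A σ : Type*} [CommRing A] [Fintype σ] (x : σ → A) :
    Ideal.ofList ((Finset.univ : Finset σ).toList.map x) = Ideal.span (Set.range x) := by
  rw [Ideal.ofList]
  congr 1
  ext a
  simp

theorem koszulExact_X {k σ : Type*} [Field k] [Fintype σ] [LinearOrder σ] {p : ℕ} (hp : 0 < p) :
    KoszulExact (MvPolynomial σ k) (X : σ → MvPolynomial σ k) p := by
  refine koszulExact_of_isWeaklyRegular X ((Finset.univ : Finset σ).toList.map X) (fun r hr => ?_)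
    (isWeaklyRegular_map_X (Finset.nodup_toList _)) p (by simpa using hp)
  obtain ⟨a, -, rfl⟩ := List.mem_map.1 hr
  exact Ideal.le_radical (Ideal.subset_span ⟨a, rfl⟩)

variable {k : Type*} [Field k] {N : ℕ} {Y : Set (ℙ k (Fin N → k))}

/-- In `∑ c v * X v` the degree `m` part only uses the degree `m - 1` parts of the coefficients. -/
theorem coordProj_mem_decomposables [Infinite k] {t : ℕ} {a : CoordRing Y} (ha : a ∈ tailIdeal Y t)
    (m : ℕ) : coordProj Y m a ∈ decomposables k (TailVar N t) (coordPiece Y) m := by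
  obtain ⟨c, rfl⟩ := Ideal.mem_span_range_iff_exists_fun.1 ha
  rw [map_sum]
  refine sum_mem fun v _ => ?_
  rw [mul_comm, coordProj_mul (isHomogeneous_X k _)]
  cases m with
  | zero => exact zero_mem _
  | succ m =>
    rw [if_pos (by simp)]
    refine mem_decomposables_succ.2 ⟨fun w => if w = v then coordProj Y m (c v) else 0,
      fun w => ?_, ?_⟩
    · dsimp only
      split_ifs
      exacts [coordProj_mem _ _, zero_mem _]
    · simp [tail_X_smul]

theorem one_notMem_tailIdeal [Infinite k] [Nontrivial (CoordRing Y)] (t : ℕ) :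
    (1 : CoordRing Y) ∉ tailIdeal Y t := by
  intro h
  have h0 : coordProj Y 0 1 = 0 := coordProj_mem_decomposables h 0
  have h1 : (1 : CoordRing Y) ∈ coordPiece Y 0 := by
    rw [coordPiece_zero]
    exact Submodule.mem_span_singleton_self _
  rw [coordProj_of_mem h1, if_pos rfl] at h0
  exact one_ne_zero h0

theorem algebraMap_tail_X (t : ℕ) (v : TailVar N t) :
    algebraMap (TailRing k N t) (CoordRing Y) (X v) = coordMap Y (X v.1) := by
  have := tail_X_smul v (1 : CoordRing Y)
  rwa [Algebra.smul_def, mul_one, mul_one] at this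

/-- The variables of `S_t` are regular on `S_t`, hence weakly regular on the flat module; their
number is the dimension. Properness holds because `1` has degree zero. -/
theorem isArithmeticallyCM_of_free [Infinite k] {n t : ℕ} (hdim : HasDim Y n)
    (hcard : Fintype.card (TailVar N t) = n + 1) [Module.Free (TailRing k N t) (CoordRing Y)] :
    IsArithmeticallyCM Y := by
  have := nontrivial_coordRing hdim
  have hmap : ((Finset.univ : Finset (TailVar N t)).toList.map X).map
      (algebraMap (TailRing k N t) (CoordRing Y)) =
      (Finset.univ : Finset (TailVar N t)).toList.map fun v => coordMap Y (X v.1) := by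
    rw [List.map_map]
    exact List.map_congr_left fun v _ => algebraMap_tail_X t v
  refine ⟨(Finset.univ : Finset (TailVar N t)).toList.map fun v => coordMap Y (X v.1), ?_, ⟨?_, ?_⟩, ?_⟩
  · intro r hr
    obtain ⟨v, -, rfl⟩ := List.mem_map.1 hr
    exact Ideal.subset_span ⟨v.1, rfl⟩
  · rw [← hmap]
    exact (isWeaklyRegular_map_X (Finset.nodup_toList _)).of_flat
  · rw [ofList_map_univ, smul_eq_mul, Ideal.mul_top]
    intro h
    exact one_notMem_tailIdeal (Y := Y) t (by rw [tailIdeal, ← h]; trivial)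
  · rw [hdim, List.length_map, Finset.length_toList, Finset.card_univ, hcard]

/-- Depth sensitivity with as many regular elements as variables. The elements lie in the irrelevant
ideal, which is contained in the radical of `tailIdeal Y t`. -/
theorem koszulExact_of_isArithmeticallyCM {n t p : ℕ} (hdim : HasDim Y n)
    (hcard : Fintype.card (TailVar N t) = n + 1)
    (hi : ∀ i, coordMap Y (X i) ∈ (tailIdeal Y t).radical) (h : IsArithmeticallyCM Y) (hp : 0 < p) :
    KoszulExact (CoordRing Y) (X : TailVar N t → TailRing k N t) p := by
  obtain ⟨rs, hrs, hreg, hlen⟩ := h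
  have hlen' : rs.length = n + 1 := by
    rw [show ringKrullDim (CoordRing Y) = _ from hdim] at hlen
    exact_mod_cast hlen.symm
  have hex : KoszulExact (CoordRing Y) (fun v : TailVar N t => coordMap Y (X v.1)) p := by
    refine koszulExact_of_isWeaklyRegular _ rs (fun r hr => ?_) hreg.toIsWeaklyRegular p (by omega)
    refine (Ideal.span_le.2 ?_ : Ideal.span _ ≤ (tailIdeal Y t).radical) (hrs r hr)
    rintro _ ⟨i, rfl⟩
    exact hi i
  have hd : ∀ c : Finset (TailVar N t) → CoordRing Y,
      familyDiff (X : TailVar N t → TailRing k N t) c =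
        familyDiff (fun v : TailVar N t => coordMap Y (X v.1)) c := fun c => by
    rw [← koszulDiff_eq_familyDiff (k := k) (fun _ _ => rfl), koszulDiff_eq_familyDiff
      (x := fun v : TailVar N t => coordMap Y (X v.1)) tail_X_smul]
  intro z hz hz0
  obtain ⟨w, hw, hwz⟩ := hex z hz (by rw [← hd, hz0])
  exact ⟨w, hw, by rw [hd, hwz]⟩

end Depth

/-! ### The graded free resolution of length zero -/

section Splitting

variable {k : Type*} [Field k] {N : ℕ} {Y : Set (ℙ k (Fin N → k))} {t : ℕ}

/-- Homogeneous elements that form a basis of the space of generators in each degree. -/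
structure IsMinimalGenerators (Y : Set (ℙ k (Fin N → k))) (t : ℕ) {b : ℕ → ℕ}
    (gen : (j : ℕ) → Fin (b j) → CoordRing Y) : Prop where
  mem : ∀ j l, gen j l ∈ coordPiece Y j
  indep : ∀ j (c : Fin (b j) → k),
    ∑ l, c l • gen j l ∈ decomposables k (TailVar N t) (coordPiece Y) j → c = 0
  span : ∀ j, coordPiece Y j ≤
    Submodule.span k (Set.range (gen j)) ⊔ decomposables k (TailVar N t) (coordPiece Y) j

/-- Lifts a basis of each quotient of `coordPiece Y j` by its decomposables, whose dimension is the
Betti number in homological degree zero. -/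
theorem exists_isMinimalGenerators (Y : Set (ℙ k (Fin N → k))) (t : ℕ) :
    ∃ gen : (j : ℕ) → Fin (gradedBetti k (TailVar N t) (coordPiece Y) 0 j) → CoordRing Y,
      IsMinimalGenerators Y t gen := by
  set D : (j : ℕ) → Submodule k (coordPiece Y j) := fun j =>
    (decomposables k (TailVar N t) (coordPiece Y) j).submoduleOf (coordPiece Y j) with hD
  let bas : (j : ℕ) → Module.Basis (Fin (gradedBetti k (TailVar N t) (coordPiece Y) 0 j)) k
      (coordPiece Y j ⧸ D j) := fun j =>
    Module.finBasisOfFinrankEq k _ (gradedBetti_zero_eq j).symm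
  choose g hg using fun j l => (D j).mkQ_surjective (bas j l)
  have hsum : ∀ j (c : Fin (gradedBetti k (TailVar N t) (coordPiece Y) 0 j) → k),
      (D j).mkQ (∑ l, c l • g j l) = ∑ l, c l • bas j l := fun j c => by
    simp only [map_sum, map_smul, hg]
  have hcoe : ∀ j (c : Fin (gradedBetti k (TailVar N t) (coordPiece Y) 0 j) → k),
      ((∑ l, c l • g j l : coordPiece Y j) : CoordRing Y) = ∑ l, c l • (g j l).1 := fun j c => by
    simp
  refine ⟨fun j l => (g j l).1, ⟨fun j l => (g j l).2, fun j c hc => ?_, fun j m hm => ?_⟩⟩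
  · have h0 : (D j).mkQ (∑ l, c l • g j l) = 0 := by
      rw [Submodule.mkQ_apply, Submodule.Quotient.mk_eq_zero]
      change ((∑ l, c l • g j l : coordPiece Y j) : CoordRing Y) ∈
        decomposables k (TailVar N t) (coordPiece Y) j
      rwa [hcoe]
    rw [hsum] at h0
    exact funext (Fintype.linearIndependent_iff.1 (bas j).linearIndependent c h0)
  · set c := (bas j).repr ((D j).mkQ ⟨m, hm⟩) with hc
    have h : (D j).mkQ (∑ l, c l • g j l) = (D j).mkQ ⟨m, hm⟩ := by
      rw [hsum]
      exact (bas j).sum_repr _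
    have h' : ∑ l, c l • (g j l).1 - m ∈ decomposables k (TailVar N t) (coordPiece Y) j := by
      rw [← hcoe]
      exact (Submodule.Quotient.eq (D j)).1 h
    rw [← sub_sub_cancel (∑ l, c l • (g j l).1) m]
    refine sub_mem (Submodule.mem_sup_left (sum_mem fun l _ => ?_)) (Submodule.mem_sup_right h')
    exact Submodule.smul_mem _ _ (Submodule.subset_span ⟨l, rfl⟩)

/-- The map from a free module given by a family of elements. -/
def generatorMap {b : ℕ → ℕ} (t r : ℕ) (gen : (j : ℕ) → Fin (b j) → CoordRing Y) :
    ((j : Fin r) → Fin (b j) → TailRing k N t) →ₗ[TailRing k N t] CoordRing Y where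
  toFun y := ∑ j : Fin r, ∑ l : Fin (b j), y j l • gen j l
  map_add' y z := by simp [add_smul, Finset.sum_add_distrib]
  map_smul' s y := by simp [mul_smul, Finset.smul_sum]

theorem generatorMap_apply {b : ℕ → ℕ} (r : ℕ) (gen : (j : ℕ) → Fin (b j) → CoordRing Y)
    (y : (j : Fin r) → Fin (b j) → TailRing k N t) :
    generatorMap t r gen y = ∑ j : Fin r, ∑ l : Fin (b j), y j l • gen j l :=
  rfl

variable {b : ℕ → ℕ} {gen : (j : ℕ) → Fin (b j) → CoordRing Y}

theorem generatorMap_single {r : ℕ} (j : Fin r) (l : Fin (b j)) :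
    generatorMap t r gen (Pi.single j (Pi.single l 1)) = gen j l := by
  rw [generatorMap_apply, Finset.sum_eq_single j, Finset.sum_eq_single l]
  · simp
  · intro l' _ hl
    simp [hl]
  · simp
  · intro j' _ hj
    simp [Pi.single_eq_of_ne hj]
  · simp

/-- Graded Nakayama, by induction on the degree: decomposables come from lower degrees, and beyond
`r` there is nothing else. -/
theorem coordPiece_le_range_generatorMap (h : IsMinimalGenerators Y t gen) {r : ℕ}
    (hr : ∀ j ≥ r, coordPiece Y j ≤ decomposables k (TailVar N t) (coordPiece Y) j) (m : ℕ) :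
    coordPiece Y m ≤ (LinearMap.range (generatorMap t r gen)).restrictScalars k := by
  have hdec : ∀ m, (∀ j < m, coordPiece Y j ≤
      (LinearMap.range (generatorMap t r gen)).restrictScalars k) →
      decomposables k (TailVar N t) (coordPiece Y) m ≤
        (LinearMap.range (generatorMap t r gen)).restrictScalars k := by
    intro m hm
    cases m with
    | zero => exact bot_le
    | succ m =>
      intro a ha
      obtain ⟨g, hg, rfl⟩ := mem_decomposables_succ.1 ha
      refine sum_mem fun v _ => ?_
      rw [Submodule.restrictScalars_mem]
      exact Submodule.smul_mem _ _ (hm m (Nat.lt_succ_self m) (hg v))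
  induction m using Nat.strong_induction_on with
  | _ m ih =>
    by_cases hm : r ≤ m
    · exact (hr m hm).trans (hdec m ih)
    · refine (h.span m).trans (sup_le ?_ (hdec m ih))
      rw [Submodule.span_le]
      rintro _ ⟨l, rfl⟩
      exact ⟨_, generatorMap_single (r := r) ⟨m, by omega⟩ l⟩

variable [Infinite k]

theorem generatorMap_surjective (h : IsMinimalGenerators Y t gen) {r : ℕ}
    (hr : ∀ j ≥ r, coordPiece Y j ≤ decomposables k (TailVar N t) (coordPiece Y) j) :
    Function.Surjective (generatorMap t r gen) := by
  intro a
  obtain ⟨n, hn⟩ := eq_sum_coordProj a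
  have : a ∈ (LinearMap.range (generatorMap t r gen)).restrictScalars k := by
    rw [hn]
    exact sum_mem fun m _ => coordPiece_le_range_generatorMap h hr m (coordProj_mem m a)
  exact this

theorem smul_mem_tailIdeal {s : TailRing k N t} (hs : constantCoeff s = 0) (a : CoordRing Y) :
    s • a ∈ tailIdeal Y t := by
  have : s ∈ Ideal.span (X '' (Set.univ : Set (TailVar N t)) : Set (TailRing k N t)) := by
    rw [mem_ideal_span_X_image]
    intro m hm
    by_contra! h0
    have : m = 0 := Finsupp.ext fun i => h0 i trivial
    rw [this, mem_support_iff] at hm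
    exact hm hs
  rw [Set.image_univ] at this
  obtain ⟨c, rfl⟩ := Ideal.mem_span_range_iff_exists_fun.1 this
  rw [Finset.sum_smul]
  refine sum_mem fun v _ => ?_
  rw [mul_comm, mul_smul, tail_X_smul]
  exact Ideal.mul_mem_right _ _ (Ideal.subset_span ⟨v, rfl⟩)

/-- Relations between minimal generators have no constant coefficients. -/
theorem constantCoeff_eq_zero_of_generatorMap (h : IsMinimalGenerators Y t gen) {r : ℕ}
    {y : (j : Fin r) → Fin (b j) → TailRing k N t} (hy : generatorMap t r gen y = 0)
    (j : Fin r) (l : Fin (b j)) : constantCoeff (y j l) = 0 := by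
  have hsplit : ∀ j l, y j l • gen j l =
      constantCoeff (y j l) • gen j l + (y j l - C (constantCoeff (y j l))) • gen j l := by
    intro j l
    rw [sub_smul, ← algebraMap_eq, algebraMap_smul, add_sub_cancel]
  have hmem : ∑ j : Fin r, ∑ l : Fin (b j), constantCoeff (y j l) • gen j l ∈ tailIdeal Y t := by
    rw [generatorMap_apply] at hy
    simp only [hsplit, Finset.sum_add_distrib] at hy
    rw [eq_neg_of_add_eq_zero_left hy]
    refine neg_mem (sum_mem fun j _ => sum_mem fun l _ => smul_mem_tailIdeal ?_ _)
    simp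
  -- The degree `j` part isolates the generators of degree `j`, which are independent modulo
  -- decomposables.
  have hproj := coordProj_mem_decomposables hmem j
  rw [map_sum, Finset.sum_eq_single j] at hproj
  · rw [map_sum, Finset.sum_congr rfl fun l _ => by
      rw [map_smul, coordProj_of_mem (h.mem _ _), if_pos rfl]] at hproj
    exact congrFun (h.indep j _ hproj) l
  · intro j' _ hj
    rw [map_sum]
    refine Finset.sum_eq_zero fun l _ => ?_
    rw [map_smul, coordProj_of_mem (h.mem _ _), if_neg (fun h => hj (Fin.ext h)), smul_zero]
  · simp

/-- Minimality puts the kernel `K` inside `𝔫F`, where `F` is the free source; vanishing of `Tor₁`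
gives `K ∩ 𝔫F = 𝔫K`. Thus `K = 𝔫K`, and Nakayama applies. -/
theorem generatorMap_injective (h : IsMinimalGenerators Y t gen) {r : ℕ}
    (hr : ∀ j ≥ r, coordPiece Y j ≤ decomposables k (TailVar N t) (coordPiece Y) j)
    (hex : KoszulExact (CoordRing Y) (X : TailVar N t → TailRing k N t) 1) :
    Function.Injective (generatorMap t r gen) := by
  set Φ := generatorMap t r gen with hΦ
  have hsurj : Function.Surjective Φ := generatorMap_surjective h hr
  set 𝔫 : Ideal (TailRing k N t) := Ideal.span (Set.range X) with hn
  have hK : LinearMap.ker Φ ≤ 𝔫 • LinearMap.ker Φ := by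
    intro y hy
    have hc : ∀ j l, y j l ∈ 𝔫 := by
      intro j l
      have h0 := constantCoeff_eq_zero_of_generatorMap h (LinearMap.mem_ker.1 hy) j l
      rw [hn, ← Set.image_univ, mem_ideal_span_X_image]
      intro m hm
      by_contra! hm0
      rw [show m = 0 from Finsupp.ext fun i => hm0 i trivial, mem_support_iff] at hm
      exact hm h0
    choose g hg using fun j l => Ideal.mem_span_range_iff_exists_fun.1 (hc j l)
    -- A 1-chain with boundary `y`. Its image under `Φ` is a cycle, hence a boundary; subtracting a
    -- lift of that boundary keeps `∂γ = y` and moves the coefficients of `γ` into the kernel.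
    set γ : Finset (TailVar N t) → ((j : Fin r) → Fin (b j) → TailRing k N t) :=
      singleChain fun v j l => g j l v with hγ
    have hγ0 : familyDiff (X : TailVar N t → TailRing k N t) γ ∅ = y := by
      rw [familyDiff_empty]
      ext1 j
      ext1 l
      rw [← hg j l]
      simp only [Finset.sum_apply, Pi.smul_apply, hγ, singleChain_singleton, smul_eq_mul]
      exact Finset.sum_congr rfl fun v _ => mul_comm _ _
    obtain ⟨w, -, hw⟩ := hex (Φ ∘ γ) (fun T hT => by
      rw [Function.comp_apply, hγ, isChain_singleChain _ T hT, map_zero]) (by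
      rw [familyDiff_comp]
      ext T
      by_cases hT : T.card = 0
      · rw [Finset.card_eq_zero.1 hT, Function.comp_apply, hγ0]
        exact LinearMap.mem_ker.1 hy
      · rw [Function.comp_apply, familyDiff_apply_eq_zero X (isChain_singleChain _) hT, map_zero]
        rfl)
    choose u hu using fun T => hsurj (w T)
    have hu' : Φ ∘ u = w := funext hu
    have hker : ∀ T, γ T - familyDiff (X : TailVar N t → TailRing k N t) u T ∈ LinearMap.ker Φ := by
      intro T
      have := congrFun hw T
      rw [← hu', familyDiff_comp] at this
      rw [LinearMap.mem_ker, map_sub, sub_eq_zero]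
      exact this.symm
    have hy2 : y = ∑ v, (X v : TailRing k N t) • (γ {v} - familyDiff (X : TailVar N t → TailRing k N t) u {v}) := by
      have h1 : familyDiff (X : TailVar N t → TailRing k N t) (γ - familyDiff (X : TailVar N t → TailRing k N t) u) ∅ = y := by
        rw [map_sub, familyDiff_familyDiff, sub_zero, hγ0]
      rw [← h1, familyDiff_empty]
      rfl
    rw [hy2]
    exact sum_mem fun v _ => Submodule.smul_mem_smul (Ideal.subset_span ⟨v, rfl⟩) (hker _)
  -- The ideal need not be in the Jacobson radical, so Nakayama only gives an annihilator `s ≡ 1`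
  -- modulo `𝔫`; it is nonzero, and the free module over a domain is torsion-free.
  obtain ⟨s, hs, hsK⟩ := Submodule.exists_sub_one_mem_and_smul_eq_zero_of_fg_of_le_smul 𝔫
    (LinearMap.ker Φ) (IsNoetherian.noetherian _) hK
  have hs0 : s ≠ 0 := by
    rintro rfl
    have hle : 𝔫 ≤ RingHom.ker (constantCoeff (R := k) (σ := TailVar N t)) := by
      rw [hn, Ideal.span_le]
      rintro _ ⟨v, rfl⟩
      simp
    have := hle hs
    simp at this
  rw [← LinearMap.ker_eq_bot, eq_bot_iff]
  intro y hy
  have := hsK y hy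
  ext1 j
  ext1 l
  exact (mul_eq_zero.1 (congrFun (congrFun this j) l)).resolve_left hs0

/-- The part of degree `m` of an element of `⨁ S(-j)^{b j}`. -/
def freePart (m : ℕ) {r : ℕ} (y : (j : Fin r) → Fin (b j) → TailRing k N t) :
    (j : Fin r) → Fin (b j) → TailRing k N t :=
  fun j l => if (j : ℕ) ≤ m then homogeneousComponent (m - j) (y j l) else 0

theorem coordProj_tail_smul {j : ℕ} {a : CoordRing Y} (ha : a ∈ coordPiece Y j) (m : ℕ)
    (s : TailRing k N t) : coordProj Y m (s • a) =
      (if j ≤ m then homogeneousComponent (m - j) s else 0) • a := by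
  obtain ⟨f, hf, rfl⟩ := mem_coordPiece_iff.1 ha
  rw [tail_smul, mul_comm, coordProj_mul hf]
  split_ifs
  · rw [coordProj_coordMap, ← rename_homogeneousComponent, mul_comm, tail_smul]
  · rw [zero_smul]

/-- Compatibility with the projections makes the bijection graded in both directions: if the image
has degree `m`, injectivity identifies `y` with its own degree `m` part. -/
theorem coordProj_generatorMap (h : ∀ j l, gen j l ∈ coordPiece Y j) (m : ℕ) {r : ℕ}
    (y : (j : Fin r) → Fin (b j) → TailRing k N t) :
    coordProj Y m (generatorMap t r gen y) = generatorMap t r gen (freePart m y) := by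
  simp only [generatorMap_apply, map_sum]
  exact Finset.sum_congr rfl fun j _ => Finset.sum_congr rfl fun l _ =>
    coordProj_tail_smul (h j l) m (y j l)

theorem mem_shiftedPiece_iff {σ : Type*} {j m : ℕ} {f : MvPolynomial σ k} : f ∈ shiftedPiece k σ j m ↔
    f = if j ≤ m then homogeneousComponent (m - j) f else 0 := by
  unfold shiftedPiece
  split_ifs with h
  · rw [mem_homogeneousSubmodule]
    refine ⟨fun hf => ?_, fun hf => ?_⟩
    · rw [homogeneousComponent_of_mem hf, if_pos rfl]
    · rw [hf]
      exact homogeneousComponent_isHomogeneous _ _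
  · simp

theorem gradedSplitting_of_koszulExact (t r : ℕ)
    (hr : ∀ j ≥ r, coordPiece Y j ≤ decomposables k (TailVar N t) (coordPiece Y) j)
    (hex : KoszulExact (CoordRing Y) (X : TailVar N t → TailRing k N t) 1) :
    GradedSplitting Y t r fun j => gradedBetti k (TailVar N t) (coordPiece Y) 0 j := by
  obtain ⟨gen, h⟩ := exists_isMinimalGenerators Y t
  have hinj := generatorMap_injective h hr hex
  refine ⟨LinearEquiv.ofBijective (generatorMap t r gen) ⟨hinj, generatorMap_surjective h hr⟩,
    fun m y => ?_⟩
  have hiff : (∀ (j : Fin r) l, y j l ∈ shiftedPiece k (TailVar N t) j m) ↔ y = freePart m y := by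
    simp only [mem_shiftedPiece_iff, funext_iff]
    rfl
  rw [hiff]
  change _ ↔ generatorMap t r gen y ∈ _
  constructor
  · intro hy
    rw [hy, ← coordProj_generatorMap h.mem]
    exact coordProj_mem _ _
  · intro hy
    apply hinj
    rw [← coordProj_generatorMap h.mem, coordProj_of_mem hy, if_pos rfl]

end Splitting

/-! ### Regularity -/

section Regularity

variable {k : Type*} [Field k] {N : ℕ} {Y : Set (ℙ k (Fin N → k))}

theorem isGradedProjection_homogeneousComponent (k σ : Type*) [Field k] [Fintype σ] [LinearOrder σ] :
    IsGradedProjection k σ (homogeneousSubmodule σ k) homogeneousComponent where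
  mem j f := homogeneousComponent_isHomogeneous j f
  eq_self _ _ hf := by rw [homogeneousComponent_of_mem hf, if_pos rfl]
  zero i f := by
    rw [smul_eq_mul, homogeneousComponent_mul_of_isHomogeneous (isHomogeneous_X k i), if_neg (by simp)]
  succ i j f := by
    rw [smul_eq_mul, homogeneousComponent_mul_of_isHomogeneous (isHomogeneous_X k i),
      if_pos (by simp), Nat.add_sub_cancel, smul_eq_mul]

theorem torVanishes_polynomial_succ (k σ : Type*) [Field k] [Fintype σ] [LinearOrder σ] (p j : ℕ) :
    TorVanishes k σ (homogeneousSubmodule σ k) (p + 1) j :=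
  (isGradedProjection_homogeneousComponent k σ).torVanishes (koszulExact_X p.succ_pos) j

theorem torVanishes_polynomial_zero (k σ : Type*) [Field k] [Fintype σ] [LinearOrder σ] (j : ℕ) :
    TorVanishes k σ (homogeneousSubmodule σ k) 0 (j + 1) := by
  have := fun j => finite_homogeneousSubmodule (k := k) (σ := σ) j
  rw [torVanishes_zero_iff]
  intro f hf
  have hf' : f.IsHomogeneous (j + 1) := hf
  have hmem : f ∈ Ideal.span (X '' (Set.univ : Set σ) : Set (MvPolynomial σ k)) := by
    rw [mem_ideal_span_X_image]
    intro m hm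
    by_contra! h0
    rw [show m = 0 from Finsupp.ext fun i => h0 i trivial, mem_support_iff] at hm
    exact hm (hf'.coeff_eq_zero (by simp))
  rw [Set.image_univ] at hmem
  obtain ⟨c, hc⟩ := Ideal.mem_span_range_iff_exists_fun.1 hmem
  refine mem_decomposables_succ.2 ⟨fun i => homogeneousComponent j (c i),
    fun i => homogeneousComponent_isHomogeneous _ _, ?_⟩
  have h := isGradedProjection_homogeneousComponent k σ
  conv_rhs => rw [← h.eq_self _ _ hf, ← hc, map_sum]
  exact Finset.sum_congr rfl fun i _ => by rw [mul_comm, ← smul_eq_mul (X i), h.succ]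

theorem koszulDiff_coordMap (c : Finset (Fin N) → MvPolynomial (Fin N) k) :
    koszulDiff k (Fin N) (fun T => coordMap Y (c T)) =
      fun T => coordMap Y (koszulDiff k (Fin N) c T) := by
  ext T
  rw [koszulDiff_apply, koszulDiff_apply, map_sum]
  exact Finset.sum_congr rfl fun i _ => by rw [map_smul, smul_eq_mul, map_mul, coordRing_smul]

theorem koszulDiff_coe (c : Finset (Fin N) → vanishingIdeal Y) :
    koszulDiff k (Fin N) (fun T => (c T : MvPolynomial (Fin N) k)) =
      fun T => ((koszulDiff k (Fin N) c T : vanishingIdeal Y) : MvPolynomial (Fin N) k) := by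
  ext1 T
  rw [koszulDiff_apply, koszulDiff_apply]
  simp

theorem mem_idealPiece_iff {a : vanishingIdeal Y} {m : ℕ} :
    a ∈ idealPiece Y m ↔ (a : MvPolynomial (Fin N) k).IsHomogeneous m :=
  Iff.rfl

instance (m : ℕ) : Module.Finite k (idealPiece Y m) := by
  have := finite_homogeneousSubmodule (k := k) (σ := Fin N) m
  let g : idealPiece Y m →ₗ[k] homogeneousSubmodule (Fin N) k m :=
    (((vanishingIdeal Y).subtype.restrictScalars k).comp (idealPiece Y m).subtype).codRestrict _
      fun a => a.2
  refine Module.Finite.of_injective g fun a b hab => ?_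
  have h : (g a : MvPolynomial (Fin N) k) = g b := by rw [hab]
  exact Subtype.ext (Subtype.ext h)

theorem exists_homogeneous_lift {p j : ℕ} {c : Finset (Fin N) → CoordRing Y}
    (hc : ∀ T, c T ∈ coordPiece Y j) (hp : IsChain p c) :
    ∃ u : Finset (Fin N) → MvPolynomial (Fin N) k,
      (∀ T, u T ∈ homogeneousSubmodule (Fin N) k j) ∧ IsChain p u ∧ ∀ T, coordMap Y (u T) = c T := by
  choose u hu huc using fun T => mem_coordPiece_iff.1 (hc T)
  refine ⟨chainPart p u, fun T => ?_, isChain_chainPart p u, fun T => ?_⟩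
  · unfold chainPart
    split_ifs
    exacts [hu T, zero_mem _]
  · unfold chainPart
    split_ifs with h
    · exact huc T
    · rw [map_zero, hp T h]

theorem koszulDiff_mem_homogeneousSubmodule {j : ℕ} {c : Finset (Fin N) → MvPolynomial (Fin N) k}
    (hc : ∀ T, c T ∈ homogeneousSubmodule (Fin N) k j) (T : Finset (Fin N)) :
    koszulDiff k (Fin N) c T ∈ homogeneousSubmodule (Fin N) k (j + 1) := by
  rw [koszulDiff_apply]
  refine sum_mem fun i _ => Submodule.smul_mem _ _ ?_
  rw [add_comm]
  exact (isHomogeneous_X k i).mul (hc _)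

theorem isChain_koszulDiff {p : ℕ} {c : Finset (Fin N) → MvPolynomial (Fin N) k}
    (hc : IsChain (p + 1) c) : IsChain p (koszulDiff k (Fin N) c) := by
  intro T hT
  rw [koszulDiff_eq_familyDiff (x := X) fun _ _ => rfl]
  exact familyDiff_apply_eq_zero X hc hT

/-- Half of the shift coming from `0 → I → R → R/I → 0`. A cycle of `I` bounds some `w` over `R`;
modulo `I` this `w` is a cycle, so correcting it by a boundary moves it into `I`. -/
theorem torVanishes_idealPiece {p j : ℕ} (h : TorVanishes k (Fin N) (coordPiece Y) (p + 1) j) :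
    TorVanishes k (Fin N) (idealPiece Y) p (j + 1) := by
  intro z hz
  rw [mem_koszulCycles] at hz
  have hzR : (fun T => (z T : MvPolynomial (Fin N) k)) ∈
      koszulCycles k (Fin N) (homogeneousSubmodule (Fin N) k) p (j + 1) := by
    refine mem_koszulCycles.2 ⟨⟨hz.1.1, fun T hT => ?_⟩, ?_⟩
    · dsimp only
      rw [hz.1.2 T hT]
      rfl
    · rw [koszulDiff_coe, hz.2]
      rfl
  have hzB : (fun T => (z T : MvPolynomial (Fin N) k)) ∈
      koszulBoundaries k (Fin N) (homogeneousSubmodule (Fin N) k) p (j + 1) := by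
    cases p with
    | zero => exact torVanishes_polynomial_zero k (Fin N) j hzR
    | succ p => exact torVanishes_polynomial_succ k (Fin N) p (j + 1) hzR
  obtain ⟨w, ⟨hw, hwc⟩, hwz⟩ := mem_koszulBoundaries_succ.1 hzB
  have hcyc : (fun T => coordMap Y (w T)) ∈ koszulCycles k (Fin N) (coordPiece Y) (p + 1) j := by
    refine mem_koszulCycles.2 ⟨⟨fun T => coordMap_mem_coordPiece (hw T), fun T hT => ?_⟩, ?_⟩
    · dsimp only
      rw [hwc T hT, map_zero]
    · rw [koszulDiff_coordMap, hwz]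
      ext T
      exact coordMap_eq_zero_iff.2 (z T).2
  have hu : ∃ u : Finset (Fin N) → MvPolynomial (Fin N) k,
      (∀ T, koszulDiff k (Fin N) u T ∈ homogeneousSubmodule (Fin N) k j) ∧ IsChain (p + 2) u ∧
      ∀ T, coordMap Y (koszulDiff k (Fin N) u T) = coordMap Y (w T) := by
    have hb := h hcyc
    cases j with
    | zero =>
      rw [mem_koszulBoundaries_zero] at hb
      refine ⟨0, fun T => ?_, fun _ _ => rfl, fun T => ?_⟩
      · rw [map_zero]
        exact zero_mem _
      · rw [map_zero, Pi.zero_apply, map_zero]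
        exact (congrFun hb T).symm
    | succ j =>
      obtain ⟨v, ⟨hv, hvc⟩, hvw⟩ := mem_koszulBoundaries_succ.1 hb
      obtain ⟨u, hu, huc, huv⟩ := exists_homogeneous_lift hv hvc
      refine ⟨u, koszulDiff_mem_homogeneousSubmodule hu, huc, fun T => ?_⟩
      rw [← congrFun (koszulDiff_coordMap (Y := Y) u) T, ← congrFun hvw T, funext huv]
  obtain ⟨u, hu, huc, huw⟩ := hu
  have hmem : ∀ T, w T - koszulDiff k (Fin N) u T ∈ vanishingIdeal Y := fun T => by
    rw [← coordMap_eq_zero_iff, map_sub, huw, sub_self]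
  refine mem_koszulBoundaries_succ.2 ⟨fun T => ⟨_, hmem T⟩, ⟨fun T => ?_, fun T hT => ?_⟩, ?_⟩
  · exact mem_idealPiece_iff.2 ((homogeneousSubmodule (Fin N) k j).sub_mem (hw T) (hu T))
  · refine Subtype.ext ?_
    change w T - koszulDiff k (Fin N) u T = 0
    rw [hwc T hT, isChain_koszulDiff huc T hT, sub_zero]
  · ext1 T
    refine Subtype.ext ?_
    rw [← congrFun (koszulDiff_coe (Y := Y) _) T]
    change koszulDiff k (Fin N) (w - koszulDiff k (Fin N) u) T = _
    rw [map_sub, koszulDiff_koszulDiff, sub_zero, hwz]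

/-- The other half: the boundary of a lift of `z` is a cycle in `I`, hence bounds there. Subtracting
makes the lift a cycle over `R`, where homology in positive degree vanishes. -/
theorem torVanishes_coordPiece {p j : ℕ} (h : TorVanishes k (Fin N) (idealPiece Y) p (j + 1)) :
    TorVanishes k (Fin N) (coordPiece Y) (p + 1) j := by
  intro z hz
  rw [mem_koszulCycles] at hz
  obtain ⟨u, hu, huc, huz⟩ := exists_homogeneous_lift hz.1.1 hz.1.2
  have hmem : ∀ T, koszulDiff k (Fin N) u T ∈ vanishingIdeal Y := fun T => by
    rw [← coordMap_eq_zero_iff, ← congrFun (koszulDiff_coordMap (Y := Y) u) T, funext huz, hz.2]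
    rfl
  have hcyc : (fun T => (⟨_, hmem T⟩ : vanishingIdeal Y)) ∈
      koszulCycles k (Fin N) (idealPiece Y) p (j + 1) := by
    refine mem_koszulCycles.2 ⟨⟨koszulDiff_mem_homogeneousSubmodule hu, fun T hT => ?_⟩, ?_⟩
    · exact Subtype.ext (isChain_koszulDiff huc T hT)
    · ext1 T
      refine Subtype.ext ?_
      rw [← congrFun (koszulDiff_coe (Y := Y) _) T]
      exact congrFun (koszulDiff_koszulDiff k (Fin N) u) T
  obtain ⟨w, ⟨hw, hwc⟩, hwu⟩ := mem_koszulBoundaries_succ.1 (h hcyc)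
  have hcycR : (u - fun T => (w T : MvPolynomial (Fin N) k)) ∈
      koszulCycles k (Fin N) (homogeneousSubmodule (Fin N) k) (p + 1) j := by
    refine mem_koszulCycles.2 ⟨⟨fun T => sub_mem (hu T) (hw T), fun T hT => ?_⟩, ?_⟩
    · rw [Pi.sub_apply, huc T hT, hwc T hT]
      exact sub_self _
    · rw [map_sub, koszulDiff_coe, hwu]
      exact sub_self _
  have hzu : ∀ T, coordMap Y ((u - fun T => (w T : MvPolynomial (Fin N) k)) T) = z T := fun T => by
    rw [Pi.sub_apply, map_sub, coordMap_eq_zero_iff.2 (w T).2, sub_zero, huz]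
  have hb := torVanishes_polynomial_succ k (Fin N) p j hcycR
  cases j with
  | zero =>
    rw [mem_koszulBoundaries_zero] at hb ⊢
    ext1 T
    rw [← hzu, hb, Pi.zero_apply, map_zero]
    rfl
  | succ j =>
    obtain ⟨v, ⟨hv, hvc⟩, hvu⟩ := mem_koszulBoundaries_succ.1 hb
    refine mem_koszulBoundaries_succ.2 ⟨fun T => coordMap Y (v T),
      ⟨fun T => coordMap_mem_coordPiece (hv T), fun T hT => ?_⟩, ?_⟩
    · dsimp only
      rw [hvc T hT, map_zero]
    · rw [koszulDiff_coordMap, hvu]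
      exact funext hzu

theorem torVanishes_of_tail {t j : ℕ} (ht : 1 ≤ t) (htN : t ≤ N)
    (h : ∀ p, TorVanishes k (TailVar N t) (coordPiece Y) p (j + 1)) :
    (∀ t', 1 ≤ t' → t' ≤ t → ∀ p, TorVanishes k (TailVar N t') (coordPiece Y) p (j + 1)) ∧
      ∀ p, TorVanishes k (Fin N) (coordPiece Y) p (j + 1) := by
  have htail : ∀ t', 1 ≤ t' → t' ≤ t →
      ∀ p, TorVanishes k (TailVar N t') (coordPiece Y) p (j + 1) := by
    intro t' ht' htt
    induction htt using Nat.decreasingInduction with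
    | self => exact h
    | of_succ s hs ih =>
      exact (isLeastExtension_tailSucc (by omega)).torVanishes_of_torVanishes tailSucc_act
        (ih (by omega)) fun _ hm => tail_X_smul_mem _ _ _ hm
  exact ⟨htail, (isLeastExtension_tailOne (by omega)).torVanishes_of_torVanishes tailOne_act
    (htail 1 le_rfl ht) fun _ hm => coordMap_X_mul_mem _ _ _ hm⟩

/-- The chain of (b)(ii) in an arbitrary strand `j`: vanishing of the next strand over `S_t` climbs
to the intermediate rings and makes every connecting map onto. -/
theorem gradedBetti_tail_le_gradedBetti {t j : ℕ} (ht : 1 ≤ t) (htN : t ≤ N)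
    (h : ∀ p, TorVanishes k (TailVar N t) (coordPiece Y) p (j + 1)) :
    gradedBetti k (TailVar N t) (coordPiece Y) 0 j ≤ gradedBetti k (Fin N) (coordPiece Y) t j := by
  have htail := (torVanishes_of_tail ht htN h).1
  have key : ∀ t', 1 ≤ t' → t' ≤ t → gradedBetti k (TailVar N t) (coordPiece Y) 0 j ≤
      gradedBetti k (TailVar N t') (coordPiece Y) (t - t') j := by
    intro t' ht' htt
    induction htt using Nat.decreasingInduction with
    | self => rw [Nat.sub_self]
    | of_succ s hs ih =>
      refine (ih (by omega)).trans ?_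
      have := gradedBetti_tailSucc_le (p := t - (s + 1)) (show s < N by omega)
        (htail (s + 1) (by omega) hs (t - (s + 1)))
      rwa [show t - (s + 1) + 1 = t - s by omega] at this
  refine (key 1 le_rfl ht).trans ?_
  have := gradedBetti_tailOne_le (p := t - 1) (show 0 < N by omega) (htail 1 le_rfl ht (t - 1))
  rwa [Nat.sub_add_cancel ht] at this

/-- If all strands over `S_t` beyond `s` vanish then the regularity of the ideal is one more than the
largest degree `s` of a generator of the coordinate ring over `S_t`. -/
theorem isRegularity_idealPiece {t s : ℕ} (ht : 1 ≤ t) (htN : t ≤ N)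
    (hs : gradedBetti k (TailVar N t) (coordPiece Y) 0 s ≠ 0)
    (h : ∀ j > s, ∀ p, TorVanishes k (TailVar N t) (coordPiece Y) p j) :
    IsRegularity k (Fin N) (idealPiece Y) (s + 1) := by
  constructor
  · refine ⟨t - 1, fun h0 => hs ?_⟩
    -- A generator of degree `s` forces `β_{t,s} ≠ 0` over `R`, which is the Betti number of the
    -- ideal in position `(t - 1, s + 1)`.
    have hle := gradedBetti_tail_le_gradedBetti ht htN (h (s + 1) (Nat.lt_succ_self s))
    have h1 := torVanishes_coordPiece (gradedBetti_eq_zero_iff.1 h0)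
    rw [Nat.sub_add_cancel ht, ← gradedBetti_eq_zero_iff] at h1
    omega
  · rintro j ⟨p, hp⟩
    by_contra hj
    obtain ⟨j, rfl⟩ : ∃ i, j = i + 2 := ⟨j - 2, by omega⟩
    exact hp (gradedBetti_eq_zero_iff.2 (torVanishes_idealPiece
      ((torVanishes_of_tail ht htN (h (j + 1) (by omega))).2 _)))

end Regularity

/-! ### The direct image of the structure sheaf -/

section Sheaf

/-! ### Scaling and basic open sets -/

section Local

variable {k σ : Type*} [Field k] [Fintype σ]

/-- Comparing coefficients of powers of `c`: weight `D` along one line forces the degree `D`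
component to carry the whole value. This makes numerators homogeneous. -/
theorem eval_homogeneousComponent_of_scaling [Infinite k] {f : MvPolynomial σ k} {v : σ → k} {D : ℕ}
    {e : k} (h : ∀ c : k, c ≠ 0 → eval (c • v) f = c ^ D * e) :
    eval v (homogeneousComponent D f) = e := by
  set n := f.totalDegree + 1 + (D + 1) with hn
  have hD : D ∈ Finset.range n := Finset.mem_range.2 (by omega)
  rw [← sub_eq_zero]
  have := eq_zero_of_sum_pow_mul_eq_zero (n := n)
    (a := fun m => eval v (homogeneousComponent m f) - if m = D then e else 0) (fun c hc => ?_)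
    (Finset.mem_range.1 hD)
  · simpa using this
  · simp only [mul_sub, Finset.sum_sub_distrib, mul_ite, mul_zero, Finset.sum_ite_eq', hD, if_true]
    rw [← h c hc, eval_smul_eq_sum, sub_eq_zero]
    refine (Finset.sum_subset (Finset.range_mono (by omega)) fun m _ hm => ?_).symm
    rw [homogeneousComponent_eq_zero m f (by simpa using hm), map_zero, mul_zero]

theorem IsTwistedSection.apply_smul {W : Set (ℙ k (σ → k))} {s : cone W → k}
    (hs : IsTwistedSection W 0 s) (w : cone W) {c : k} (hc : c ≠ 0) :
    s ⟨c • w.1, smul_mem_cone w.2 hc⟩ = s w := by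
  obtain ⟨a, b, f, g, hf, hg, hab, hw, h⟩ := hs w
  obtain rfl : a = b := by omega
  have hcw : eval (c • w.1) g ≠ 0 := by
    rw [eval_smul_of_isHomogeneous hg]
    exact mul_ne_zero (pow_ne_zero _ hc) hw
  rw [h w hw, h ⟨c • w.1, smul_mem_cone w.2 hc⟩ hcw]
  dsimp only
  rw [eval_smul_of_isHomogeneous hg, eval_smul_of_isHomogeneous hf,
    mul_div_mul_left _ _ (pow_ne_zero _ hc)]

theorem isTwistedSection_eval {W : Set (ℙ k (σ → k))} {f : MvPolynomial σ k} {m : ℕ}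
    (hf : f.IsHomogeneous m) : IsTwistedSection W m fun v => eval v.1 f :=
  fun _ => ⟨m, 0, f, 1, hf, isHomogeneous_one _ _, by simp, by simp, fun _ _ => by simp⟩

/-- Basic open sets, defined by forms of positive degree, form a basis of the topology. -/
theorem exists_basicOpen {U : Set (ℙ k (σ → k))} (hU : IsZariskiOpen U) {u : σ → k}
    (hu : u ∈ cone U) : ∃ (a : ℕ) (h : MvPolynomial σ k), 1 ≤ a ∧ h.IsHomogeneous a ∧
      eval u h ≠ 0 ∧ ∀ w, eval w h ≠ 0 → w ∈ cone U := by
  obtain ⟨F, hF, hUF⟩ := hU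
  obtain ⟨hu0, huU⟩ := hu
  have hnot : Projectivization.mk k u hu0 ∉ Uᶜ := fun h => h huU
  rw [hUF, Set.mem_ofPred_eq] at hnot
  push Not at hnot
  obtain ⟨f, hf, hfu⟩ := hnot
  obtain ⟨m, hm⟩ := hF f hf
  rw [ne_eq, eval_rep_eq_zero_iff hm] at hfu
  obtain ⟨i, hi⟩ := Function.ne_iff.1 hu0
  -- The factor `X i` makes the degree positive and excludes the origin from the locus of
  -- nonvanishing.
  refine ⟨m + 1, f * X i, by omega, hm.mul (isHomogeneous_X k i), ?_, fun w hw => ?_⟩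
  · rw [map_mul, eval_X]
    exact mul_ne_zero hfu hi
  · rw [map_mul, eval_X] at hw
    have hw0 : w ≠ 0 := fun h => right_ne_zero_of_mul hw (by rw [h]; rfl)
    refine ⟨hw0, ?_⟩
    by_contra hc
    have hc' : Projectivization.mk k w hw0 ∈ Uᶜ := hc
    rw [hUF] at hc'
    exact left_ne_zero_of_mul hw ((eval_rep_eq_zero_iff hm w hw0).1 (hc' f hf))

end Local

variable {k : Type*} [Field k] {N : ℕ} {Y : Set (ℙ k (Fin N → k))} {t : ℕ}

/-- The coordinates of a vector with index at least `t`. -/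
def tailVec (t : ℕ) (v : Fin N → k) : TailVar N t → k := fun i => v i

theorem mem_cone_projPreimage {U : Set (ℙ k (TailVar N t → k))} {v : Fin N → k} (hv : v ∈ cone Y)
    (hU : tailVec t v ∈ cone U) : v ∈ cone (projPreimage Y t U) := by
  obtain ⟨hv0, hY⟩ := hv
  obtain ⟨ht0, hU⟩ := hU
  obtain ⟨a, ha⟩ := Projectivization.exists_smul_eq_mk_rep k v hv0
  have key : ∀ i, (Projectivization.mk k v hv0).rep i = (a : k) * v i := fun i => by
    rw [← ha]
    rfl
  have hp : Projectivization.mk k v hv0 ∉ coordSubspace k N t := fun hp => ht0 <| funext fun i => by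
    have := hp i
    rw [key] at this
    exact (mul_eq_zero.1 this).resolve_left a.ne_zero
  refine ⟨hv0, hY, hp, ?_⟩
  convert hU using 1
  unfold linearProjection
  rw [Projectivization.mk_eq_mk_iff']
  exact ⟨a, funext fun i => (key i).symm⟩

theorem cone_projPreimage_le {U : Set (ℙ k (TailVar N t → k))} {v : Fin N → k}
    (hv : v ∈ cone (projPreimage Y t U)) : v ∈ cone Y :=
  ⟨hv.1, hv.2.1⟩

theorem eval_rename_tail (v : Fin N → k) (f : TailRing k N t) :
    eval v (rename Subtype.val f) = eval (tailVec t v) f :=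
  eval_rename _ _ _

/-- Pullback of twisted sections along the projection. -/
theorem IsTwistedSection.tail_pullback {U : Set (ℙ k (TailVar N t → k))} {m : ℤ} {s : cone U → k}
    (hs : IsTwistedSection U m s) : IsTwistedSection (projPreimage Y t U) m
      fun v => s ⟨tailVec t v.1, tail_mem_cone v.2⟩ := by
  intro v
  obtain ⟨a, b, f, g, hf, hg, hab, hv, h⟩ := hs ⟨tailVec t v.1, tail_mem_cone v.2⟩
  refine ⟨a, b, rename Subtype.val f, rename Subtype.val g, hf.rename_isHomogeneous,
    hg.rename_isHomogeneous, hab, ?_, fun w hw => ?_⟩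
  · rwa [eval_rename_tail]
  · rw [eval_rename_tail] at hw ⊢
    rw [eval_rename_tail]
    exact h ⟨tailVec t w.1, tail_mem_cone w.2⟩ hw

variable {r : ℕ} {b : ℕ → ℕ}

/-- Homogeneous polynomials that form a graded basis of the coordinate ring over `S_t`. -/
structure IsPolynomialBasis (Y : Set (ℙ k (Fin N → k))) (t : ℕ)
    (G : (j : Fin r) → Fin (b j) → MvPolynomial (Fin N) k) : Prop where
  homogeneous : ∀ j l, (G j l).IsHomogeneous j
  indep : ∀ y : (j : Fin r) → Fin (b j) → TailRing k N t,
    ∑ j, ∑ l, rename Subtype.val (y j l) * G j l ∈ vanishingIdeal Y → y = 0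
  span : ∀ D (f : MvPolynomial (Fin N) k), f.IsHomogeneous D →
    ∃ y : (j : Fin r) → Fin (b j) → TailRing k N t,
      (∀ (j : Fin r) l, y j l ∈ shiftedPiece k (TailVar N t) j D) ∧
      f - ∑ j, ∑ l, rename Subtype.val (y j l) * G j l ∈ vanishingIdeal Y

/-- Lifts the images of the standard basis to forms, so that the splitting can be evaluated at
points of the cone. -/
theorem GradedSplitting.exists_isPolynomialBasis (h : GradedSplitting Y t r b) :
    ∃ G : (j : Fin r) → Fin (b j) → MvPolynomial (Fin N) k, IsPolynomialBasis Y t G := by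
  obtain ⟨Φ, hΦ⟩ := h
  have hmem : ∀ (j : Fin r) (l : Fin (b j)), Φ (Pi.single j (Pi.single l 1)) ∈ coordPiece Y j := by
    intro j l
    rw [← hΦ]
    intro j' l'
    by_cases hj : j' = j
    · subst hj
      rw [Pi.single_eq_same]
      by_cases hl : l' = l
      · subst hl
        rw [Pi.single_eq_same, shiftedPiece, if_pos le_rfl, Nat.sub_self]
        exact isHomogeneous_one _ _
      · rw [Pi.single_eq_of_ne hl]
        exact zero_mem _
    · rw [Pi.single_eq_of_ne hj]
      exact zero_mem _
  choose G hG hGΦ using fun j l => mem_coordPiece_iff.1 (hmem j l)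
  have hsum : ∀ y : (j : Fin r) → Fin (b j) → TailRing k N t,
      Φ y = coordMap Y (∑ j, ∑ l, rename Subtype.val (y j l) * G j l) := by
    intro y
    have hy : y = ∑ j, ∑ l, y j l • Pi.single j (Pi.single l (1 : TailRing k N t)) := by
      ext1 j
      ext1 l
      rw [Finset.sum_apply, Finset.sum_eq_single j, Finset.sum_apply, Finset.sum_apply,
        Finset.sum_eq_single l]
      · simp
      · intro l' _ hl
        simp [Ne.symm hl]
      · simp
      · intro j' _ hj
        simp [Ne.symm hj]
      · simp
    conv_lhs => rw [hy]
    simp only [map_sum, map_smul, map_mul, hGΦ, tail_smul]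
  refine ⟨G, hG, fun y hy => ?_, fun D f hf => ?_⟩
  · rw [← coordMap_eq_zero_iff, ← hsum] at hy
    exact Φ.map_eq_zero_iff.1 hy
  · refine ⟨Φ.symm (coordMap Y f), ?_, ?_⟩
    · rw [hΦ, LinearEquiv.apply_symm_apply]
      exact coordMap_mem_coordPiece hf
    · rw [← coordMap_eq_zero_iff, map_sub, ← hsum, LinearEquiv.apply_symm_apply, sub_self]

variable {G : (j : Fin r) → Fin (b j) → MvPolynomial (Fin N) k}

/-- Uniqueness of coefficients on a basic open set: after multiplication by `h` the relation
vanishes on the whole cone, so independence gives `h * y = 0`. -/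
theorem IsPolynomialBasis.eval_eq_zero (hG : IsPolynomialBasis Y t G) {h : TailRing k N t}
    {y : (j : Fin r) → Fin (b j) → TailRing k N t}
    (hy : ∀ v ∈ cone Y, eval (tailVec t v) h ≠ 0 →
      ∑ j, ∑ l, eval (tailVec t v) (y j l) * eval v (G j l) = 0)
    {u : TailVar N t → k} (hu : eval u h ≠ 0) (j : Fin r) (l : Fin (b j)) : eval u (y j l) = 0 := by
  have h0 : (fun j l => h * y j l) = 0 := by
    refine hG.indep _ fun v hv => ?_
    simp only [map_sum, map_mul, eval_rename_tail, mul_assoc, ← Finset.mul_sum]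
    by_cases hv0 : eval (tailVec t v) h = 0
    · rw [hv0, zero_mul]
    · rw [hy v hv hv0, mul_zero]
  have := congrArg (eval u) (congrFun (congrFun h0 j) l)
  rw [map_mul, Pi.zero_apply, Pi.zero_apply, map_zero] at this
  exact (mul_eq_zero.1 this).resolve_left hu

/-- The combination of the basis `G` with twisted sections as coefficients. -/
def sheafMap (Y : Set (ℙ k (Fin N → k))) (t : ℕ) (hG : ∀ j l, (G j l).IsHomogeneous j)
    (U : Set (ℙ k (TailVar N t → k))) :
    ((j : Fin r) → Fin (b j) → twistedSections U (-((j : ℕ) : ℤ))) →+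
      regularFunctions (projPreimage Y t U) where
  toFun s := ⟨fun v => ∑ j, ∑ l, (s j l).1 ⟨tailVec t v.1, tail_mem_cone v.2⟩ * eval v.1 (G j l), by
    have h : ∀ j l, (fun v : cone (projPreimage Y t U) =>
        (s j l).1 ⟨tailVec t v.1, tail_mem_cone v.2⟩ * eval v.1 (G j l)) ∈
        regularFunctions (projPreimage Y t U) := fun j l => by
      have := (IsTwistedSection.tail_pullback (Y := Y) (s j l).2).mul
        (isTwistedSection_eval (W := projPreimage Y t U) (hG j l))
      rwa [neg_add_cancel] at this
    convert (regularFunctions (projPreimage Y t U)).sum_mem fun j (_ : j ∈ Finset.univ) =>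
      (regularFunctions (projPreimage Y t U)).sum_mem fun l (_ : l ∈ Finset.univ) => h j l using 1
    ext v
    simp only [Finset.sum_apply]⟩
  map_zero' := by
    ext v
    simp
  map_add' s s' := by
    ext v
    simp [add_mul, Finset.sum_add_distrib]

theorem sheafMap_apply (hG : ∀ j l, (G j l).IsHomogeneous j) (U : Set (ℙ k (TailVar N t → k)))
    (s : (j : Fin r) → Fin (b j) → twistedSections U (-((j : ℕ) : ℤ)))
    (v : cone (projPreimage Y t U)) : (sheafMap Y t hG U s).1 v =
      ∑ j, ∑ l, (s j l).1 ⟨tailVec t v.1, tail_mem_cone v.2⟩ * eval v.1 (G j l) :=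
  rfl

theorem IsPolynomialBasis.sheafMap_injective (hG : IsPolynomialBasis Y t G)
    {U : Set (ℙ k (TailVar N t → k))} (hU : IsZariskiOpen U) :
    Function.Injective (sheafMap Y t hG.homogeneous U) := by
  rw [injective_iff_map_eq_zero]
  intro s hs
  ext j l u
  obtain ⟨a, h₀, -, -, hu₀, hU₀⟩ := exists_basicOpen hU u.2
  choose a' b' f g _ _ _ hgu hsg using fun j l => (s j l).2 u
  -- A common denominator near `u` turns the relation between sections into one between polynomials.
  set g' : TailRing k N t := ∏ j, ∏ l, g j l with hg'
  have hdvd : ∀ j l, g j l ∣ g' := fun j l =>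
    (Finset.dvd_prod_of_mem (g j) (Finset.mem_univ l)).trans
      (Finset.dvd_prod_of_mem (fun j => ∏ l, g j l) (Finset.mem_univ j))
  choose q hq using hdvd
  have hgu' : eval u.1 g' ≠ 0 := by
    rw [hg', map_prod]
    refine Finset.prod_ne_zero_iff.2 fun j _ => ?_
    rw [map_prod]
    exact Finset.prod_ne_zero_iff.2 fun l _ => hgu j l
  have hval : ∀ (w : cone U), eval w.1 g' ≠ 0 → ∀ j l,
      eval w.1 (f j l * q j l) = eval w.1 g' * (s j l).1 w := by
    intro w hw j l
    have hgw : eval w.1 (g j l) ≠ 0 := by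
      rw [hq j l, map_mul] at hw
      exact left_ne_zero_of_mul hw
    rw [hsg j l w hgw, map_mul]
    conv_rhs => rw [hq j l, map_mul]
    field_simp
  have h0 : eval u.1 (f j l * q j l) = 0 := by
    refine hG.eval_eq_zero (h := h₀ * g') (y := fun j l => f j l * q j l) (fun v hv hv0 => ?_) ?_ j l
    · rw [map_mul] at hv0
      have htU := hU₀ _ (left_ne_zero_of_mul hv0)
      have hvU := mem_cone_projPreimage hv htU
      have h1 := congrArg (fun φ => φ.1 ⟨v, hvU⟩) hs
      rw [sheafMap_apply] at h1
      simp only [hval ⟨tailVec t v, htU⟩ (right_ne_zero_of_mul hv0), mul_assoc, ← Finset.mul_sum]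
      rw [h1]
      exact mul_zero _
    · rw [map_mul]
      exact mul_ne_zero hu₀ hgu'
  rw [hval u hgu'] at h0
  exact (mul_eq_zero.1 h0).resolve_left hgu'

/-- A regular function on the preimage of a basic open set is a global fraction. -/
theorem exists_fraction [IsAlgClosed k] (hY : IsAlgebraicSet Y) {U : Set (ℙ k (TailVar N t → k))}
    (φ : regularFunctions (projPreimage Y t U)) {h : TailRing k N t} {a : ℕ} (ha : h.IsHomogeneous a)
    (hU : ∀ w, eval w h ≠ 0 → w ∈ cone U) (m : ℕ) :
    ∃ q ≥ m, ∃ f : MvPolynomial (Fin N) k, f.IsHomogeneous (a * q) ∧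
      ∀ v : cone (projPreimage Y t U), eval (tailVec t v.1) h ≠ 0 →
        eval (tailVec t v.1) h ^ q * φ.1 v = eval v.1 f := by
  -- The ideal of denominators of `φ` over `h ≠ 0`. Showing that `h` vanishes on its zero locus
  -- replaces a quasi-compactness argument by the Nullstellensatz.
  let J : Ideal (MvPolynomial (Fin N) k) :=
    { carrier := {g | ∃ f : MvPolynomial (Fin N) k, ∀ v : cone (projPreimage Y t U),
        eval (tailVec t v.1) h ≠ 0 → eval v.1 g * φ.1 v = eval v.1 f}
      add_mem' := by
        rintro g g' ⟨f, hf⟩ ⟨f', hf'⟩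
        exact ⟨f + f', fun v hv => by rw [map_add, map_add, add_mul, hf v hv, hf' v hv]⟩
      zero_mem' := ⟨0, fun v _ => by simp⟩
      smul_mem' := by
        rintro c g ⟨f, hf⟩
        exact ⟨c * f, fun v hv => by rw [smul_eq_mul, map_mul, map_mul, mul_assoc, hf v hv]⟩ }
  have hrad : rename Subtype.val h ∈ J.radical := by
    rw [← vanishingIdeal_zeroLocus_eq_radical (K := k) J]
    intro w hw
    replace hw : ∀ g ∈ J, eval w g = 0 := fun g hg => by
      have := mem_zeroLocus_iff.1 hw g hg
      rwa [← coe_aeval_eq_eval]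
    change eval w (rename Subtype.val h) = 0
    rw [eval_rename_tail]
    by_contra hne
    have hwU := hU _ hne
    have hw0 : w ≠ 0 := by
      rintro rfl
      exact hwU.1 rfl
    have hwY : w ∈ cone Y := mem_cone_of_forall_vanishingIdeal hY hw0 fun f hf => hw f ⟨0, fun v _ => by
      rw [hf v.1 (cone_projPreimage_le v.2), zero_mul, map_zero]⟩
    obtain ⟨c, d, f, g, -, -, -, hg, hφ⟩ := φ.2 ⟨w, mem_cone_projPreimage hwY hwU⟩
    -- The formula `φ = f / g` says nothing where `g = 0`; the extra factor makes both sides vanish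
    -- there.
    have hgg : g * g ∈ J := ⟨f * g, fun v _ => by
      by_cases hgv : eval v.1 g = 0
      · simp [hgv]
      · rw [hφ v hgv, map_mul, map_mul]
        field_simp⟩
    have := hw _ hgg
    rw [map_mul] at this
    exact (mul_ne_zero hg hg) this
  obtain ⟨p, hp⟩ := hrad
  obtain ⟨f, hf⟩ : rename Subtype.val h ^ (p + m) ∈ J := by
    rw [pow_add]
    exact J.mul_mem_right _ hp
  refine ⟨p + m, by omega, homogeneousComponent (a * (p + m)) f,
    homogeneousComponent_isHomogeneous _ _, fun v hv => ?_⟩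
  have : Infinite k := IsAlgClosed.instInfinite
  symm
  refine eval_homogeneousComponent_of_scaling fun c hc => ?_
  have htail : tailVec t (c • v.1) = c • tailVec t v.1 := rfl
  have hcv : eval (tailVec t (c • v.1)) h ≠ 0 := by
    rw [htail, eval_smul_of_isHomogeneous ha]
    exact mul_ne_zero (pow_ne_zero _ hc) hv
  have h1 := hf ⟨c • v.1, smul_mem_cone v.2 hc⟩ hcv
  rw [IsTwistedSection.apply_smul φ.2 v hc] at h1
  dsimp only at h1
  rw [← h1, map_pow, eval_rename_tail, htail, eval_smul_of_isHomogeneous ha, mul_pow, ← pow_mul,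
    mul_assoc]

theorem IsPolynomialBasis.exists_local_sections [IsAlgClosed k] (hG : IsPolynomialBasis Y t G)
    (hY : IsAlgebraicSet Y) {U : Set (ℙ k (TailVar N t → k))} (hU : IsZariskiOpen U)
    (φ : regularFunctions (projPreimage Y t U)) (u : cone U) :
    ∃ (a : ℕ) (h : TailRing k N t) (y : (j : Fin r) → Fin (b j) → TailRing k N t),
      h.IsHomogeneous a ∧ eval u.1 h ≠ 0 ∧ (∀ w, eval w h ≠ 0 → w ∈ cone U) ∧ r ≤ a ∧
      (∀ j l, (y j l).IsHomogeneous (a - j)) ∧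
      ∀ v : cone (projPreimage Y t U), eval (tailVec t v.1) h ≠ 0 →
        eval (tailVec t v.1) h * φ.1 v = ∑ j, ∑ l, eval (tailVec t v.1) (y j l) * eval v.1 (G j l) := by
  obtain ⟨a, h, ha, hh, hu, hU'⟩ := exists_basicOpen hU u.2
  obtain ⟨q, hq, f, hf, hfφ⟩ := exists_fraction hY φ hh hU' (r + 1)
  obtain ⟨y, hy, hyf⟩ := hG.span _ f hf
  -- Uses `a ≥ 1` and `q ≥ r + 1`; it ensures that the degrees `a * q - j` are not truncated.
  have hra : r ≤ a * q := by nlinarith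
  refine ⟨a * q, h ^ q, y, hh.pow q, ?_, fun w hw => hU' w ?_, hra, fun j l => ?_, fun v hv => ?_⟩
  · rw [map_pow]
    exact pow_ne_zero _ hu
  · rw [map_pow] at hw
    exact fun h0 => hw (by rw [h0, zero_pow (by omega)])
  · have := hy j l
    rwa [shiftedPiece, if_pos (by omega)] at this
  · rw [map_pow] at hv ⊢
    rw [hfφ v fun h0 => hv (by rw [h0, zero_pow (by omega)])]
    have := hyf v.1 (cone_projPreimage_le v.2)
    rw [map_sub, sub_eq_zero] at this
    rw [this]
    simp only [map_sum, map_mul, eval_rename_tail]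

/-- Local expansions of `φ` glue because their coefficients are unique on overlaps. -/
theorem IsPolynomialBasis.sheafMap_surjective [IsAlgClosed k] (hG : IsPolynomialBasis Y t G)
    (hY : IsAlgebraicSet Y) {U : Set (ℙ k (TailVar N t → k))} (hU : IsZariskiOpen U) :
    Function.Surjective (sheafMap Y t hG.homogeneous U) := by
  intro φ
  choose a h y hh hu hUh hra hy hφ using hG.exists_local_sections hY hU φ
  have hcompat : ∀ (u w : cone U), eval w.1 (h u) ≠ 0 → ∀ j l,
      eval w.1 (y w j l) / eval w.1 (h w) = eval w.1 (y u j l) / eval w.1 (h u) := by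
    intro u w hw j l
    have h0 : eval w.1 (y u j l * h w - y w j l * h u) = 0 := by
      refine hG.eval_eq_zero (h := h u * h w) (y := fun j l => y u j l * h w - y w j l * h u)
        (fun v hv hv0 => ?_) ?_ j l
      · rw [map_mul] at hv0
        have hvU := mem_cone_projPreimage hv (hUh u _ (left_ne_zero_of_mul hv0))
        have h1 := hφ u ⟨v, hvU⟩ (left_ne_zero_of_mul hv0)
        have h2 := hφ w ⟨v, hvU⟩ (right_ne_zero_of_mul hv0)
        dsimp only at h1 h2
        have hsplit : ∀ j l, eval (tailVec t v) (y u j l * h w - y w j l * h u) * eval v (G j l) =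
            eval (tailVec t v) (h w) * (eval (tailVec t v) (y u j l) * eval v (G j l)) -
            eval (tailVec t v) (h u) * (eval (tailVec t v) (y w j l) * eval v (G j l)) := by
          intro j l
          rw [map_sub, map_mul, map_mul]
          ring
        simp only [hsplit, Finset.sum_sub_distrib, ← Finset.mul_sum]
        rw [← h1, ← h2]
        ring
      · rw [map_mul]
        exact mul_ne_zero hw (hu w)
    rw [map_sub, map_mul, map_mul, sub_eq_zero] at h0
    rw [div_eq_div_iff (hu w) hw, h0]
  -- The value at `w` comes from the expansion chosen at `w` itself; compatibility lets the one
  -- chosen at `u` serve as a fraction on all of `h u ≠ 0`.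
  refine ⟨fun j l => ⟨fun w => eval w.1 (y w j l) / eval w.1 (h w), fun u => ?_⟩, ?_⟩
  · refine ⟨a u - j, a u, y u j l, h u, hy u j l, hh u, ?_, hu u, fun w hw => hcompat u w hw j l⟩
    have := hra u
    have := j.2
    omega
  · ext v
    rw [sheafMap_apply]
    set u : cone U := ⟨tailVec t v.1, tail_mem_cone v.2⟩ with hu'
    have h1 := hφ u v (hu u)
    have h2 : eval (tailVec t v.1) (h u) ≠ 0 := hu u
    simp only [div_mul_eq_mul_div, ← Finset.sum_div]
    rw [div_eq_iff h2, mul_comm, h1]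

theorem nonempty_sheafSplitting [IsAlgClosed k] (hY : IsAlgebraicSet Y)
    (h : GradedSplitting Y t r b) : Nonempty (SheafSplitting Y t r b) := by
  obtain ⟨G, hG⟩ := h.exists_isPolynomialBasis
  refine ⟨⟨fun U hU => AddEquiv.ofBijective (sheafMap Y t hG.homogeneous U)
    ⟨hG.sheafMap_injective hU, hG.sheafMap_surjective hY hU⟩, fun U hU ρ s => ?_,
    fun U V hU hV hVU s => ?_⟩⟩
  · ext v
    change (∑ j, ∑ l, (ρ.1 _ * (s j l).1 _) * eval v.1 (G j l)) =
      ρ.1 _ * ∑ j, ∑ l, (s j l).1 _ * eval v.1 (G j l)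
    simp only [Finset.mul_sum, mul_assoc]
    rfl
  · rfl

end Sheaf

/-! ### The coordinate ring as a free module -/

section Free

variable {k : Type*} [Field k] [IsAlgClosed k] {N n t s : ℕ} {Y : Set (ℙ k (Fin N → k))}

theorem gradedSplitting_of_isArithmeticallyCM (hdim : HasDim Y n) (hcard : Fintype.card (TailVar N t) = n + 1)
    (hi : ∀ i, coordMap Y (X i) ∈ (tailIdeal Y t).radical)
    (hs : ∀ j > s, TorVanishes k (TailVar N t) (coordPiece Y) 0 j) (h : IsArithmeticallyCM Y) :
    GradedSplitting Y t (s + 1) fun j => gradedBetti k (TailVar N t) (coordPiece Y) 0 j :=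
  have : Infinite k := IsAlgClosed.instInfinite
  gradedSplitting_of_koszulExact t (s + 1) (fun j hj => torVanishes_zero_iff.1 (hs j hj))
    (koszulExact_of_isArithmeticallyCM hdim hcard hi h one_pos)

theorem GradedSplitting.free {r : ℕ} {b : ℕ → ℕ} (h : GradedSplitting Y t r b) :
    Module.Free (TailRing k N t) (CoordRing Y) := by
  obtain ⟨Φ, -⟩ := h
  exact Module.Free.of_equiv Φ

theorem torVanishes_of_isArithmeticallyCM (hdim : HasDim Y n)
    (hcard : Fintype.card (TailVar N t) = n + 1)
    (hi : ∀ i, coordMap Y (X i) ∈ (tailIdeal Y t).radical)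
    (hs : ∀ j > s, TorVanishes k (TailVar N t) (coordPiece Y) 0 j) (h : IsArithmeticallyCM Y) :
    ∀ j > s, ∀ p, TorVanishes k (TailVar N t) (coordPiece Y) p j := by
  have : Infinite k := IsAlgClosed.instInfinite
  intro j hj p
  cases p with
  | zero => exact hs j hj
  | succ p =>
    exact (isGradedProjection_coordProj_tail Y t).torVanishes
      (koszulExact_of_isArithmeticallyCM hdim hcard hi h p.succ_pos) j

end Free

end ProjSyz

end

/-! ### Proof of the theorem -/

open ProjSyz
theorem mainTheorem4 {k : Type*} [Field k] [IsAlgClosed k] [CharZero k]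
    (n e α d : ℕ) (he : 1 ≤ e) (hα : α ≤ e)
    (X : Set (Projectivization k (Fin (n + e + 1) → k)))
    (hX : IsAlgebraicSet X) (hdim : HasDim X n) (hnd : IsNondegenerate X)
    (hΛ : Disjoint X (coordSubspace k (n + e + 1) α))
    (hN : PropertyN k (Fin (n + e + 1)) (coordPiece X) d α) :
    -- (a)
    PropertyN k (TailVar (n + e + 1) α) (coordPiece X) d 0 ∧
    -- (b)(i)
    gradedBetti k (TailVar (n + e + 1) α) (coordPiece X) 0 0 = 1 ∧
    gradedBetti k (TailVar (n + e + 1) α) (coordPiece X) 0 1 = α ∧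
    (∀ i, 2 ≤ i → i ≤ d - 1 →
      gradedBetti k (TailVar (n + e + 1) α) (coordPiece X) 0 i ≤ (α + i - 1).choose i) ∧
    -- (b)(ii)
    (∀ t, 1 ≤ t → t < α →
      gradedBetti k (TailVar (n + e + 1) (t + 1)) (coordPiece X) (α - (t + 1)) (d - 1) ≤
        gradedBetti k (TailVar (n + e + 1) t) (coordPiece X) (α - t) (d - 1)) ∧
    (1 ≤ α →
      gradedBetti k (TailVar (n + e + 1) 1) (coordPiece X) (α - 1) (d - 1) ≤
        gradedBetti k (Fin (n + e + 1)) (coordPiece X) α (d - 1)) ∧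
    -- (c)
    (α = e →
      (Module.Free (TailRing k (n + e + 1) α) (CoordRing X) ↔ IsArithmeticallyCM X) ∧
      (Module.Free (TailRing k (n + e + 1) α) (CoordRing X) →
        ∃ r, 2 ≤ r ∧ IsRegularity k (Fin (n + e + 1)) (idealPiece X) r ∧
          GradedSplitting X α r
            (fun j => gradedBetti k (TailVar (n + e + 1) α) (coordPiece X) 0 j) ∧
          Nonempty (SheafSplitting X α r
            (fun j => gradedBetti k (TailVar (n + e + 1) α) (coordPiece X) 0 j)))) := by
  have hinf : Infinite k := IsAlgClosed.instInfinite
  have hnt := nontrivial_coordRing hdim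
  have hαN : α < n + e + 1 := by omega
  have hi := coordMap_X_mem_radical hX hΛ
  have hv : ∀ p ≤ α, ∀ j ≥ d, TorVanishes k (Fin (n + e + 1)) (coordPiece X) p j :=
    fun p hp j hj => gradedBetti_eq_zero_iff.1 (hN p hp j hj)
  have hzero := torVanishes_tail_zero hαN hi hv
  have htail := torVanishes_tail hαN hi hv
  -- The unit is a generator in degree zero, so the strands from `d` on cannot include it; this
  -- makes `d - 1` honest.
  have hd : 1 ≤ d := by
    by_contra hd
    have h0 := gradedBetti_eq_zero_iff.2 (hzero 0 (by omega))
    rw [gradedBetti_tail_zero_zero] at h0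
    exact one_ne_zero h0
  have h01 := gradedBetti_tail_zero_one hnd hαN.le
  refine ⟨fun p hp j hj => ?_, gradedBetti_tail_zero_zero α, h01,
    fun i _ _ => gradedBetti_tail_zero_le hαN.le i, fun t ht htα => ?_, fun hα1 => ?_, ?_⟩
  · obtain rfl := Nat.le_zero.1 hp
    exact gradedBetti_eq_zero_iff.2 (hzero j hj)
  · have := gradedBetti_tailSucc_le (p := α - (t + 1)) (j := d - 1) (show t < n + e + 1 by omega)
      (htail (t + 1) (by omega) _ (by omega) _ (by omega))
    rwa [show α - (t + 1) + 1 = α - t by omega] at this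
  · have := gradedBetti_tailOne_le (p := α - 1) (j := d - 1) (show 0 < n + e + 1 by omega)
      (htail 1 le_rfl _ (by omega) _ (by omega))
    rwa [Nat.sub_add_cancel hα1] at this
  · intro hαe
    have hcard : Fintype.card (TailVar (n + e + 1) α) = n + 1 := by
      have := card_tailVar hαN.le
      omega
    have h1 : gradedBetti k (TailVar (n + e + 1) α) (coordPiece X) 0 1 ≠ 0 := by omega
    -- The top degree of a generator over `S_e`. The search may stop at `d` by part (a), and `s ≥ 1`
    -- since there are `e ≥ 1` generators of degree one; hence `r = s + 1 ≥ 2`.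
    set s := Nat.findGreatest
      (fun j => gradedBetti k (TailVar (n + e + 1) α) (coordPiece X) 0 j ≠ 0) d with hs
    have hs1 : 1 ≤ s := Nat.le_findGreatest hd h1
    have hsne : gradedBetti k (TailVar (n + e + 1) α) (coordPiece X) 0 s ≠ 0 :=
      Nat.findGreatest_spec
        (P := fun j => gradedBetti k (TailVar (n + e + 1) α) (coordPiece X) 0 j ≠ 0) hd h1
    have hsgt : ∀ j > s, TorVanishes k (TailVar (n + e + 1) α) (coordPiece X) 0 j := by
      intro j hj
      by_cases hjd : d ≤ j
      · exact hzero j hjd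
      · exact gradedBetti_eq_zero_iff.1
          (not_not.1 (Nat.findGreatest_is_greatest hj (by omega)))
    refine ⟨⟨fun _ => isArithmeticallyCM_of_free hdim hcard, fun h =>
      (gradedSplitting_of_isArithmeticallyCM hdim hcard hi hsgt h).free⟩, fun _ => ?_⟩
    have hcm : IsArithmeticallyCM X := isArithmeticallyCM_of_free (t := α) hdim hcard
    have hsplit := gradedSplitting_of_isArithmeticallyCM hdim hcard hi hsgt hcm
    exact ⟨s + 1, by omega, isRegularity_idealPiece (by omega) hαN.le hsne
      (torVanishes_of_isArithmeticallyCM hdim hcard hi hsgt hcm), hsplit,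
      nonempty_sheafSplitting hX hsplit⟩
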